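/- **Setting.** For an integer $m$ let $\Delta_m=\{v\in\mathbb R_+^m:\sum_j v_j=1\}$. Let $A=[A_1,\dots,A_K]$ be a $p\times K$ matrix with columns $A_k\in\Delta_p$. One observes $n$ independent word-count vectors $Y^{(j)}\sim\mathrm{Multinomial}_p(N,A\alpha^{(j)})$, $j=1,\dots,n$, with $\alpha^{(j)}\in\Delta_K$. A word $j\in[p]$ is an anchor word of topic $k$ if $A_{jk}>0$ and $A_{jk'}=0$ for all $k'\ne k$. For constants $c_A>0$ and $c_m\in(0,1)$ let $\Theta_A$ be the set of matrices $A$ with columns in $\Delta_p$ such that $\min_{j}\max_k A_{jk}\ge c_A/p$, every topic has at least one anchor word, and the number of anchor words is at most $c_m p$. Let $\Theta_\alpha(\tau)=\{\alpha\in\Delta_K:\|\alpha\|_0\le\tau\}$. For $J\subseteq[p]$ and $s\ge1$ put $$\kappa(A_J,s)=\min_{|S|\le s}\ \min_{v\ne0,\ \|v_S\|_1\ge\|v_{S^c}\|_1}\frac{\|A_Jv\|_1}{\|v\|_1},\qquad \overline\kappa_\tau(A)=\min_{\alpha\in\Theta_\alpha(\tau)}\kappa\bigl(A_{\overline J(\alpha)},\|\alpha\|_0\bigr),\quad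 \overline J(\alpha)=\{j:(A\alpha)_j>0\}.$$ Let $d$ be a metric on $\Delta_p$, let $W(\cdot,\cdot;d)$ be the Wasserstein distance of order one between probability measures on $(\Delta_p,d)$, and for weights $\alpha$ and topics $A$ let $\boldsymbol\alpha=\sum_{k}\alpha_k\delta_{A_k}$ be the mixing measure. **Theorem.** For all constants $c_A>0$, $c_m\in(0,1)$, $c>0$, $c'>0$ there is a constant $C>0$, depending only on these four, such that the following holds. Let $p,K,n,N,\tau$ be integers with $1<\tau\le K$, $\tau\le cN$ and $pK\le c'nN$; let $d$ be a metric on $\Delta_p$ and $c_d>0$ with $c_d\|u-v\|_1\le 2d(u,v)$ for all $u,v\in\Delta_p$. Fix a document $i\in[n]$ and arbitrary weights $\alpha^{(j)}\in\Delta_K$ for the documents $j\neq i$, and let $\Theta_i$ be the set of those $\alpha\in\Theta_\alpha(\tau)$ for which the $K\times n$ matrix with $i$-th column $\alpha$ and $j$-th column $\alpha^{(j)}$ ($j\ne i$) has rank $K$; assume that $\Theta_i$ is not empty. Then for every $A^0\in\Theta_A$ $$\inf_{\widehat{\boldsymbol\alpha}}\ \sup_{\alpha\in\Theta_i,\,A\in\Theta_A}\mathbb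 E\bigl[W(\widehat{\boldsymbol\alpha},\boldsymbol\alpha;d)\bigr]\ \ge\ C\,c_d\left(\overline\kappa_\tau(A^0)\sqrt{\frac{\tau}{N}}+\sqrt{\frac{pK}{nN}}\right),$$ where the expectation is over the data with $\alpha^{(i)}=\alpha$, and the infimum is over all maps $\widehat{\boldsymbol\alpha}$ (which may depend on the $\alpha^{(j)}$, $j\ne i$) from the data $(Y^{(1)},\dots,Y^{(n)})$ to the Borel probability measures on $(\Delta_p,d)$. If $\overline\kappa_\tau(A^0)>0$, the right-hand side equals $C c_d\,\overline\kappa_\tau(A^0)\bigl(\sqrt{\tau/N}+\overline\kappa_\tau(A^0)^{-1}\sqrt{pK/(nN)}\bigr)$. -/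

import Mathlib

open MeasureTheory
open scoped ENNReal

noncomputable section

namespace TopicModel

/-- The probability simplex in `ℝ^m`. -/
abbrev Simplex (m : ℕ) : Type := stdSimplex ℝ (Fin m)

/-- The `ℓ¹` distance between two probability vectors. -/
def l1Dist {m : ℕ} (u v : Simplex m) : ℝ := ∑ j, |u j - v j|

/-- The set of indices of the nonzero weights. -/
def supp {K : ℕ} (α : Simplex K) : Finset (Fin K) := Finset.univ.filter fun k => α k ≠ 0

/-- Mixture weights with at most `τ` nonzero coordinates. -/
def sparseWeights (K τ : ℕ) : Set (Simplex K) := {α | (supp α).card ≤ τ}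

/-! The `p × K` matrix of topics is given by its columns `A k`, which are probability vectors;
its entry in row `j` and column `k` is `A k j`. -/

/-- Word `j` is an anchor word of topic `k`. -/
def IsAnchor {p K : ℕ} (A : Fin K → Simplex p) (j : Fin p) (k : Fin K) : Prop :=
  0 < A k j ∧ ∀ k', k' ≠ k → A k' j = 0

open scoped Classical in
/-- The set of all anchor words. -/
def anchorWords {p K : ℕ} (A : Fin K → Simplex p) : Finset (Fin p) :=
  Finset.univ.filter fun j => ∃ k, IsAnchor A j k

/-- The class of topic matrices: every row has sup norm at least `cA / p`, every topic has an
anchor word, and there are at most `cm * p` anchor words. -/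
def topicMatrices (p K : ℕ) (cA cm : ℝ) : Set (Fin K → Simplex p) :=
  {A | (∀ j : Fin p, cA / p ≤ ‖fun k : Fin K => A k j‖) ∧
    (∀ k, ∃ j, IsAnchor A j k) ∧ ((anchorWords A).card : ℝ) ≤ cm * p}

/-- The word distribution `r = A α`. -/
def wordProb {p K : ℕ} (A : Fin K → Simplex p) (α : Simplex K) (j : Fin p) : ℝ :=
  ∑ k, A k j * α k

/-- The words `j` with `r_j > 0`, where `r = A α`. -/
def wordSupp {p K : ℕ} (A : Fin K → Simplex p) (α : Simplex K) : Finset (Fin p) :=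
  Finset.univ.filter fun j => 0 < wordProb A α j

/-- The restricted `ℓ¹ → ℓ¹` condition number `κ(A_J, s)` of the rows of `A` indexed by `J`: the
minimum of `‖A_J v‖₁ / ‖v‖₁` over all `S` with `|S| ≤ s` and all nonzero `v` such that
`‖v_S‖₁ ≥ ‖v_{Sᶜ}‖₁`. -/
def condNumber {p K : ℕ} (A : Fin K → Simplex p) (J : Finset (Fin p)) (s : ℕ) : ℝ :=
  sInf {x : ℝ | ∃ S : Finset (Fin K), S.card ≤ s ∧ ∃ v : Fin K → ℝ, v ≠ 0 ∧
    ∑ k ∈ Sᶜ, |v k| ≤ ∑ k ∈ S, |v k| ∧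
    x = (∑ j ∈ J, |∑ k, A k j * v k|) / ∑ k, |v k|}

/-- The minimum of `κ(A_J, ‖α‖₀)`, with `J = {j : (A α)_j > 0}`, over all `τ`-sparse weights `α`. -/
def kappaBar {p K : ℕ} (A : Fin K → Simplex p) (τ : ℕ) : ℝ :=
  sInf {x : ℝ | ∃ α ∈ sparseWeights K τ, x = condNumber A (wordSupp A α) (supp α).card}

/-- The `p`-dimensional multinomial distribution with `N` trials and cell probabilities `r`: the
law of the vector of counts of `N` independent draws from `r`. -/
def multinomial {p : ℕ} (N : ℕ) (r : Fin p → ℝ) : Measure (Fin p → ℕ) :=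
  (Measure.pi fun _ : Fin N => ∑ j, ENNReal.ofReal (r j) • Measure.dirac j).map
    fun w j => (Finset.univ.filter fun t => w t = j).card

/-- The joint law of the word counts of `n` independent documents of length `N`, the `i`-th one
with mixture weights `T i`. -/
def corpusLaw {p K n : ℕ} (N : ℕ) (A : Fin K → Simplex p) (T : Fin n → Simplex K) :
    Measure (Fin n → Fin p → ℕ) :=
  Measure.pi fun i => multinomial N (wordProb A (T i))

/-- The simplex as a metric space with the metric `d` and its Borel `σ`-algebra. -/
def MetricSimplex (p : ℕ) (_d : MetricSpace (Simplex p)) : Type := Simplex p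

instance {p : ℕ} (d : MetricSpace (Simplex p)) : MetricSpace (MetricSimplex p d) := d

instance {p : ℕ} (d : MetricSpace (Simplex p)) : MeasurableSpace (MetricSimplex p d) := borel _

instance {p : ℕ} (d : MetricSpace (Simplex p)) : BorelSpace (MetricSimplex p d) := ⟨rfl⟩

/-- A point of the simplex as a point of the metric space. -/
def toMetric {p : ℕ} (d : MetricSpace (Simplex p)) (u : Simplex p) : MetricSimplex p d := u

/-- The Wasserstein distance (of order one) between two measures on a metric space: the infimum
of the transport cost over all couplings. -/
def wasserstein {X : Type} [MetricSpace X] [MeasurableSpace X] (μ ν : Measure X) : ℝ≥0∞ :=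
  ⨅ (π : Measure (X × X)) (_ : π.map Prod.fst = μ ∧ π.map Prod.snd = ν),
    ∫⁻ z, edist z.1 z.2 ∂π

/-- The mixing measure `∑ k, α_k δ_{A_k}` on the simplex with the metric `d`. -/
def mixingMeasure {p K : ℕ} (d : MetricSpace (Simplex p)) (A : Fin K → Simplex p)
    (α : Simplex K) : Measure (MetricSimplex p d) :=
  ∑ k, ENNReal.ofReal (α k) • Measure.dirac (toMetric d (A k))

/-- The `τ`-sparse weights `α` of document `i` for which the `K × n` matrix of all mixture weights,
the weights of the documents other than `i` being those of `T`, has rank `K`. -/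
def admissibleWeights {K n : ℕ} (τ : ℕ) (i : Fin n) (T : Fin n → Simplex K) : Set (Simplex K) :=
  {α | α ∈ sparseWeights K τ ∧
    (Matrix.of fun (k : Fin K) (i' : Fin n) => Function.update T i α i' k).rank = K}

/-- The minimax risk, in Wasserstein distance, for the mixing measure of document `i` from the word
counts of all `n` documents, the mixture weights of the documents other than `i` being fixed to
those of `T` (`T i` plays no role). The infimum is over all maps from the data to
the probability measures on the simplex with the metric `d`. -/
def minimaxRisk {p K n : ℕ} (d : MetricSpace (Simplex p)) (cA cm : ℝ) (N τ : ℕ) (i : Fin n)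
    (T : Fin n → Simplex K) : ℝ≥0∞ :=
  ⨅ est : (Fin n → Fin p → ℕ) → ProbabilityMeasure (MetricSimplex p d),
    ⨆ α ∈ admissibleWeights τ i T, ⨆ A ∈ topicMatrices p K cA cm,
      ∫⁻ Y, wasserstein (est Y : Measure (MetricSimplex p d)) (mixingMeasure d A α)
        ∂(corpusLaw N A (Function.update T i α))

end TopicModel

end

noncomputable section

namespace TopicModel

/-! ### The law of the words of the corpus -/

/-! The mean of the mixing measure is the word distribution `A α`, and averaging a point over a
coupling shows that the Wasserstein distance is at least `cd / 2` times the ℓ¹ distance of the means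
(`wasserstein_ge`). It therefore suffices to bound the ℓ¹ risk of estimating `A α` from below, for
which Assouad's lemma is used over a cube of models: neighbouring models must have Hellinger
affinity bounded below, while ℓ¹ distances must grow linearly in the Hamming distance
(`exists_risk_ge`, `le_minimaxRisk`). Both cubes move small masses `± g` between coordinates in a
set `J` and one balancing coordinate `o` of a simplex point (`Perturbable`).

For the first term the topics are fixed at `A₀` and the weights of document `i` are perturbed on `τ`
topics, each perturbation having size about `1 / √(τ N)`. Only this document changes, and `kappaBar`
converts ℓ¹ distance of weights into ℓ¹ distance of word distributions. The rank condition excludes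
at most a hyperplane of weights (`exists_functional`), which a free parameter of the base point
avoids.

For the second term the weights are fixed and one topic is perturbed at its non-anchor words, of
which there are at least `(1 - cm) * p`. The topic is chosen with total weight at most `2 n / K`
over the corpus, yet weight at least `1 / 2` in document `i` (`exists_light_topic`): the data say
little about it, but the loss is sensitive to it. The constraints of the class persist because,
after relabelling, this topic is needed to bound at most `p / K` rows, and a fixed share of its mass
remains free (`exists_perturbable_topic`).

The maximum of the two bounds is at least half their sum. -/

lemma sum_simplex {m : ℕ} (u : Simplex m) : ∑ j, u j = 1 := u.2.2

lemma simplex_nonneg {m : ℕ} (u : Simplex m) (j : Fin m) : 0 ≤ u j := u.2.1 j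

lemma simplex_le_one {m : ℕ} (u : Simplex m) (j : Fin m) : u j ≤ 1 := by
  rw [← sum_simplex u]
  exact Finset.single_le_sum (f := fun j => u j) (fun j _ => u.2.1 j) (Finset.mem_univ j)

lemma wordProb_nonneg {p K : ℕ} (A : Fin K → Simplex p) (α : Simplex K) (j : Fin p) :
    0 ≤ wordProb A α j :=
  Finset.sum_nonneg fun k _ => mul_nonneg ((A k).2.1 j) (α.2.1 k)

lemma sum_wordProb {p K : ℕ} (A : Fin K → Simplex p) (α : Simplex K) :
    ∑ j, wordProb A α j = 1 := by
  unfold wordProb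
  rw [Finset.sum_comm]
  have h : ∀ k, ∑ j, A k j * α k = α k := fun k => by
    rw [← Finset.sum_mul, sum_simplex, one_mul]
  simp only [h]
  exact sum_simplex α

/-- The law of one word. -/
def wordLaw {p : ℕ} (r : Fin p → ℝ) : Measure (Fin p) :=
  ∑ j, ENNReal.ofReal (r j) • Measure.dirac j

lemma wordLaw_singleton {p : ℕ} (r : Fin p → ℝ) (j : Fin p) :
    wordLaw r {j} = ENNReal.ofReal (r j) := by
  simp [wordLaw, Measure.finsetSum_apply, Set.indicator_apply]

lemma isProbabilityMeasure_wordLaw {p : ℕ} {r : Fin p → ℝ} (h0 : ∀ j, 0 ≤ r j)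
    (h1 : ∑ j, r j = 1) : IsProbabilityMeasure (wordLaw r) := by
  constructor
  simp only [wordLaw, Measure.finsetSum_apply, Measure.smul_apply, measure_univ, smul_eq_mul,
    mul_one]
  rw [← ENNReal.ofReal_sum_of_nonneg fun j _ => h0 j, h1, ENNReal.ofReal_one]

/-- The number of occurrences of each word in a document. -/
def wordCount {p N : ℕ} (w : Fin N → Fin p) (j : Fin p) : ℕ :=
  (Finset.univ.filter fun t => w t = j).card

/-- The probability that the words of the corpus are `w`. -/
def corpusProb {p n N : ℕ} (r : Fin n → Fin p → ℝ) (w : Fin n → Fin N → Fin p) : ℝ :=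
  ∏ i, ∏ t, r i (w i t)

/-- The counts are a function of the ordered words, so expectations become finite sums over word
sequences with product probabilities. No measurability of `f` is needed, the count space being
discrete. -/
lemma lintegral_corpusLaw {p K n N : ℕ} (A : Fin K → Simplex p) (T : Fin n → Simplex K)
    (f : (Fin n → Fin p → ℕ) → ℝ≥0∞) :
    ∫⁻ Y, f Y ∂(corpusLaw N A T) = ∑ w : Fin n → Fin N → Fin p,
      f (fun i => wordCount (w i)) * ENNReal.ofReal (corpusProb (fun i => wordProb A (T i)) w) := by
  have hw : ∀ i, IsProbabilityMeasure (wordLaw (wordProb A (T i))) := fun i =>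
    isProbabilityMeasure_wordLaw (wordProb_nonneg A _) (sum_wordProb A _)
  have hm : Measurable (wordCount : (Fin N → Fin p) → Fin p → ℕ) := measurable_of_finite _
  have hp : ∀ i, IsProbabilityMeasure ((Measure.pi fun _ : Fin N =>
      wordLaw (wordProb A (T i))).map wordCount) :=
    fun i => Measure.isProbabilityMeasure_map hm.aemeasurable
  have e : corpusLaw N A T = (Measure.pi fun i => Measure.pi fun _ : Fin N =>
      wordLaw (wordProb A (T i))).map fun w i => wordCount (w i) := by
    rw [Measure.pi_map_pi fun i => hm.aemeasurable]
    rfl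
  have hm' : Measurable fun (w : Fin n → Fin N → Fin p) i => wordCount (w i) :=
    measurable_of_finite _
  rw [e, lintegral_map Measurable.of_discrete hm', lintegral_fintype]
  refine Finset.sum_congr rfl fun w _ => ?_
  rw [Measure.pi_singleton]
  simp only [Measure.pi_singleton, wordLaw_singleton, corpusProb]
  rw [ENNReal.ofReal_prod_of_nonneg fun i _ =>
    Finset.prod_nonneg fun _ _ => wordProb_nonneg A _ _]
  congr 1
  refine Finset.prod_congr rfl fun i _ => ?_
  rw [ENNReal.ofReal_prod_of_nonneg fun t _ => wordProb_nonneg A _ _]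

/-- The rows of `r` need not sum to one: with `√(r * r')` in place of `r` this is the tensorization
of the Hellinger affinity. -/
lemma sum_corpusProb {p n N : ℕ} (r : Fin n → Fin p → ℝ) :
    ∑ w : Fin n → Fin N → Fin p, corpusProb r w = ∏ i, (∑ j, r i j) ^ N := by
  have h := Finset.prod_univ_sum (fun _ : Fin n => (Finset.univ : Finset (Fin N → Fin p)))
    (fun i (u : Fin N → Fin p) => ∏ t, r i (u t))
  rw [Fintype.piFinset_univ] at h
  unfold corpusProb
  rw [← h]
  refine Finset.prod_congr rfl fun i _ => ?_
  have h' := Finset.prod_univ_sum (fun _ : Fin N => (Finset.univ : Finset (Fin p)))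
    (fun _ j => r i j)
  rw [Fintype.piFinset_univ] at h'
  rw [← h']
  simp

lemma corpusProb_nonneg {p n N : ℕ} {r : Fin n → Fin p → ℝ} (h : ∀ i j, 0 ≤ r i j)
    (w : Fin n → Fin N → Fin p) : 0 ≤ corpusProb r w :=
  Finset.prod_nonneg fun i _ => Finset.prod_nonneg fun _ _ => h i _

/-! ### The Wasserstein distance and the means -/

/-- A coordinate of a point of the simplex with the metric `d`. -/
def coord {p : ℕ} (d : MetricSpace (Simplex p)) (j : Fin p) (u : MetricSimplex p d) : ℝ :=
  DFunLike.coe (F := Simplex p) u j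

lemma coord_nonneg {p : ℕ} (d : MetricSpace (Simplex p)) (j : Fin p) (u : MetricSimplex p d) :
    0 ≤ coord d j u := simplex_nonneg (m := p) u j

lemma coord_le_one {p : ℕ} (d : MetricSpace (Simplex p)) (j : Fin p) (u : MetricSimplex p d) :
    coord d j u ≤ 1 := simplex_le_one (m := p) u j

lemma sum_abs_coord_sub_le {p : ℕ} {d : MetricSpace (Simplex p)} {cd : ℝ}
    (hd : ∀ u v : Simplex p, cd * l1Dist u v ≤ 2 * d.dist u v) (u v : MetricSimplex p d) :
    cd * ∑ j, |coord d j u - coord d j v| ≤ 2 * dist u v := hd u v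

/-- The Borel structure is that of `d`, not the Euclidean one; the lower bound on `d` makes
coordinates `2 / cd`-Lipschitz. -/
lemma measurable_coord {p : ℕ} (d : MetricSpace (Simplex p)) {cd : ℝ} (hcd : 0 < cd)
    (hd : ∀ u v : Simplex p, cd * l1Dist u v ≤ 2 * d.dist u v) (j : Fin p) :
    Measurable (coord d j) := by
  refine Continuous.measurable ?_
  refine (LipschitzWith.of_dist_le_mul (K := (2 / cd).toNNReal) fun u v => ?_).continuous
  rw [Real.coe_toNNReal _ (by positivity), Real.dist_eq]
  have h1 : |coord d j u - coord d j v| ≤ ∑ j, |coord d j u - coord d j v| :=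
    Finset.single_le_sum (f := fun j => |coord d j u - coord d j v|)
      (fun j _ => abs_nonneg _) (Finset.mem_univ j)
  have h2 := sum_abs_coord_sub_le hd u v
  rw [div_mul_eq_mul_div, le_div_iff₀ hcd]
  nlinarith

/-- The mean of a measure on the simplex. -/
def meanVec {p : ℕ} (d : MetricSpace (Simplex p)) (μ : Measure (MetricSimplex p d))
    (j : Fin p) : ℝ :=
  ∫ u, coord d j u ∂μ

lemma wasserstein_ge {p : ℕ} (d : MetricSpace (Simplex p)) {cd : ℝ} (hcd : 0 < cd)
    (hd : ∀ u v : Simplex p, cd * l1Dist u v ≤ 2 * d.dist u v)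
    (μ ν : Measure (MetricSimplex p d)) [IsProbabilityMeasure μ] :
    ENNReal.ofReal (cd / 2 * ∑ j, |meanVec d μ j - meanVec d ν j|) ≤ wasserstein μ ν := by
  refine le_iInf₂ fun π hπ => ?_
  obtain ⟨h1, h2⟩ := hπ
  have hπ : IsProbabilityMeasure π := by
    constructor
    have : (π.map Prod.fst) Set.univ = 1 := by rw [h1]; exact measure_univ
    rwa [Measure.map_apply measurable_fst MeasurableSet.univ, Set.preimage_univ] at this
  have hm := measurable_coord d hcd hd
  have hint : ∀ (f : MetricSimplex p d × MetricSimplex p d → MetricSimplex p d),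
      Measurable f → ∀ j, Integrable (fun z => coord d j (f z)) π := fun f hf j => by
    refine Integrable.of_bound ((hm j).comp hf).aestronglyMeasurable 1 (.of_forall fun z => ?_)
    rw [Real.norm_eq_abs, abs_of_nonneg (coord_nonneg d j _)]
    exact coord_le_one d j _
  have hi : ∀ j, Integrable
      (fun z : MetricSimplex p d × MetricSimplex p d =>
        coord d j z.1 - coord d j z.2) π :=
    fun j => (hint _ measurable_fst j).sub (hint _ measurable_snd j)
  have hmean : ∀ j, |meanVec d μ j - meanVec d ν j| ≤
      ∫ z, |coord d j z.1 - coord d j z.2| ∂π := fun j => by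
    have e : meanVec d μ j - meanVec d ν j =
        ∫ z, (coord d j z.1 - coord d j z.2) ∂π := by
      rw [integral_sub (hint _ measurable_fst j) (hint _ measurable_snd j), meanVec, meanVec,
        ← h1, ← h2, integral_map measurable_fst.aemeasurable (hm j).aestronglyMeasurable,
        integral_map measurable_snd.aemeasurable (hm j).aestronglyMeasurable]
    rw [e]
    exact abs_integral_le_integral_abs
  calc ENNReal.ofReal (cd / 2 * ∑ j, |meanVec d μ j - meanVec d ν j|)
      ≤ ENNReal.ofReal (∫ z, cd / 2 * ∑ j, |coord d j z.1 - coord d j z.2| ∂π) := by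
        refine ENNReal.ofReal_le_ofReal ?_
        rw [integral_const_mul, integral_finsetSum _ fun j _ => (hi j).abs]
        gcongr with j
        exact hmean j
    _ = ∫⁻ z, ENNReal.ofReal (cd / 2 * ∑ j, |coord d j z.1 - coord d j z.2|) ∂π := by
        refine ofReal_integral_eq_lintegral_ofReal ?_ (.of_forall fun z => ?_)
        · exact (integrable_finsetSum _ fun j _ => (hi j).abs).const_mul _
        · exact mul_nonneg (by positivity) (Finset.sum_nonneg fun j _ => abs_nonneg _)
    _ ≤ ∫⁻ z, edist z.1 z.2 ∂π := by
        refine lintegral_mono fun z => ?_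
        rw [edist_dist]
        refine ENNReal.ofReal_le_ofReal ?_
        have h := sum_abs_coord_sub_le hd z.1 z.2
        linarith

lemma meanVec_mixingMeasure {p K : ℕ} (d : MetricSpace (Simplex p)) {cd : ℝ} (hcd : 0 < cd)
    (hd : ∀ u v : Simplex p, cd * l1Dist u v ≤ 2 * d.dist u v) (A : Fin K → Simplex p)
    (α : Simplex K) (j : Fin p) : meanVec d (mixingMeasure d A α) j = wordProb A α j := by
  unfold meanVec mixingMeasure wordProb
  have hm := (measurable_coord d hcd hd j).stronglyMeasurable
  rw [integral_finsetSum_measure]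
  · refine Finset.sum_congr rfl fun k _ => ?_
    rw [integral_smul_measure, integral_dirac' _ _ hm, ENNReal.toReal_ofReal (simplex_nonneg α k),
      smul_eq_mul, mul_comm]
    rfl
  · intro k _
    refine Integrable.smul_measure ?_ ENNReal.ofReal_ne_top
    exact integrable_dirac' hm (by simp)

/-! ### Assouad's lemma -/

/-- The opposite of a bit string in coordinate `b`. -/
def flipBit {B : Type*} [DecidableEq B] (b : B) (ω : B → Bool) : B → Bool :=
  Function.update ω b (!ω b)

lemma flipBit_self {B : Type*} [DecidableEq B] (b : B) (ω : B → Bool) :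
    flipBit b ω b = !ω b := by simp [flipBit]

lemma flipBit_of_ne {B : Type*} [DecidableEq B] {b b' : B} (h : b' ≠ b) (ω : B → Bool) :
    flipBit b ω b' = ω b' := by simp [flipBit, h]

lemma flipBit_flipBit {B : Type*} [DecidableEq B] (b : B) (ω : B → Bool) :
    flipBit b (flipBit b ω) = ω := by
  ext b'
  by_cases h : b' = b
  · subst h; simp [flipBit]
  · simp [flipBit, h]

/-- Flipping a coordinate, as a permutation of the bit strings. -/
def flipEquiv {B : Type*} [DecidableEq B] (b : B) : Equiv.Perm (B → Bool) :=
  ⟨flipBit b, flipBit b, flipBit_flipBit b, flipBit_flipBit b⟩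

/-- Assouad's lemma: the probabilities `P ω` on a finite set are such that those of neighbouring
bit strings have a common mass of at least `η`. -/
lemma assouad {B Ω : Type*} [Fintype B] [DecidableEq B] [Fintype Ω] (P : (B → Bool) → Ω → ℝ)
    (η : ℝ) (hη : ∀ ω b, η ≤ ∑ w, min (P ω w) (P (flipBit b ω) w)) (est : Ω → B → Bool) :
    ∃ ω, η * Fintype.card B / 2 ≤ ∑ w, P ω w * hammingDist (est w) ω := by
  have hb : ∀ b, Fintype.card (B → Bool) * (η / 2) ≤
      ∑ ω, ∑ w, P ω w * if est w b ≠ ω b then 1 else 0 := fun b => by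
    have e := Equiv.sum_comp (flipEquiv b)
      fun ω => ∑ w, P ω w * if est w b ≠ ω b then (1 : ℝ) else 0
    have h : ∀ ω, η ≤ (∑ w, P ω w * if est w b ≠ ω b then (1 : ℝ) else 0) +
        ∑ w, P (flipBit b ω) w * if est w b ≠ flipBit b ω b then (1 : ℝ) else 0 := fun ω => by
      refine (hη ω b).trans ?_
      rw [← Finset.sum_add_distrib]
      refine Finset.sum_le_sum fun w _ => ?_
      rw [flipBit_self]
      -- The decoded bit is wrong for exactly one of the two neighbours, so one of the two masses is
      -- always paid, and it is at least their minimum.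
      cases est w b <;> cases ω b <;> simp
    have h2 := Finset.sum_le_sum fun ω (_ : ω ∈ Finset.univ) => h ω
    rw [Finset.sum_add_distrib, Finset.sum_const, Finset.card_univ, nsmul_eq_mul] at h2
    change ∑ ω, ∑ w, P (flipBit b ω) w * (if est w b ≠ flipBit b ω b then (1 : ℝ) else 0) = _ at e
    rw [e] at h2
    linarith
  by_contra! hcon
  have h1 : ∑ ω, ∑ w, P ω w * hammingDist (est w) ω < 
      ∑ _ω : B → Bool, η * Fintype.card B / 2 :=
    Finset.sum_lt_sum_of_nonempty Finset.univ_nonempty fun ω _ => hcon ω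
  have h2 := Finset.sum_le_sum fun b (_ : b ∈ Finset.univ) => hb b
  have e : ∑ b, ∑ ω, ∑ w, P ω w * (if est w b ≠ ω b then (1 : ℝ) else 0) =
      ∑ ω, ∑ w, P ω w * hammingDist (est w) ω := by
    rw [Finset.sum_comm]
    refine Finset.sum_congr rfl fun ω _ => ?_
    rw [Finset.sum_comm]
    refine Finset.sum_congr rfl fun w _ => ?_
    rw [← Finset.mul_sum, hammingDist, Finset.sum_boole]
  rw [e] at h2
  simp only [Finset.sum_const, Finset.card_univ, nsmul_eq_mul] at h1 h2
  linarith

/-! ### Hellinger affinity -/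

/-- Le Cam's inequality: `P * Q = min * max`, so Cauchy–Schwarz bounds the squared affinity by the
common mass times the total of the maxima, which is at most `2`. -/
lemma sum_min_ge {Ω : Type*} [Fintype Ω] {P Q : Ω → ℝ} (hP : ∀ w, 0 ≤ P w) (hQ : ∀ w, 0 ≤ Q w)
    (hP1 : ∑ w, P w = 1) (hQ1 : ∑ w, Q w = 1) (h : 1 / 2 ≤ ∑ w, √(P w * Q w)) :
    1 / 8 ≤ ∑ w, min (P w) (Q w) := by
  have h1 : ∑ w, √(P w * Q w) ≤ √(∑ w, min (P w) (Q w)) * √(∑ w, max (P w) (Q w)) := by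
    refine le_trans (Finset.sum_le_sum fun w _ => ?_) (Real.sum_sqrt_mul_sqrt_le _
      (fun w => le_min (hP w) (hQ w)) (fun w => (hP w).trans (le_max_left _ _)))
    rw [← Real.sqrt_mul (le_min (hP w) (hQ w)), min_mul_max]
  have h2 : ∑ w, max (P w) (Q w) ≤ 2 := by
    calc ∑ w, max (P w) (Q w) ≤ ∑ w, (P w + Q w) := Finset.sum_le_sum fun w _ =>
          max_le (by linarith [hQ w]) (by linarith [hP w])
      _ = 2 := by rw [Finset.sum_add_distrib, hP1, hQ1]; norm_num
  have h0 : 0 ≤ ∑ w, min (P w) (Q w) := Finset.sum_nonneg fun w _ => le_min (hP w) (hQ w)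
  have h0' : 0 ≤ ∑ w, max (P w) (Q w) :=
    Finset.sum_nonneg fun w _ => (hP w).trans (le_max_left _ _)
  rw [← Real.sqrt_mul h0] at h1
  have h3 := (Real.le_sqrt' (by norm_num)).1 (h.trans h1)
  nlinarith

/-- A Bernoulli-type inequality. It makes affinity deficits subadditive, over the words of a
document and then over the documents. -/
lemma one_sub_sum_le_prod {ι : Type*} (s : Finset ι) {ρ : ι → ℝ} (h0 : ∀ i, 0 ≤ ρ i)
    (h1 : ∀ i, ρ i ≤ 1) : 1 - ∑ i ∈ s, (1 - ρ i) ≤ ∏ i ∈ s, ρ i := by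
  classical
  induction s using Finset.induction_on with
  | empty => simp
  | insert i s hi ih =>
    rw [Finset.sum_insert hi, Finset.prod_insert hi]
    have hs : 0 ≤ ∑ i ∈ s, (1 - ρ i) := Finset.sum_nonneg fun i _ => by linarith [h1 i]
    nlinarith [h0 i, h1 i, mul_le_mul_of_nonneg_left ih (h0 i), mul_nonneg (sub_nonneg.2 (h1 i)) hs]

lemma sqrt_corpusProb_mul {p n N : ℕ} {r r' : Fin n → Fin p → ℝ} (h : ∀ i j, 0 ≤ r i j)
    (h' : ∀ i j, 0 ≤ r' i j) (w : Fin n → Fin N → Fin p) :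
    √(corpusProb r w * corpusProb r' w) = corpusProb (fun i j => √(r i j * r' i j)) w := by
  unfold corpusProb
  rw [← Finset.prod_mul_distrib, Real.sqrt_prod _ fun i _ => mul_nonneg
    (Finset.prod_nonneg fun t _ => h i _) (Finset.prod_nonneg fun t _ => h' i _)]
  refine Finset.prod_congr rfl fun i _ => ?_
  rw [← Finset.prod_mul_distrib, Real.sqrt_prod _ fun t _ => mul_nonneg (h i _) (h' i _)]

lemma sum_sqrt_mul_le_one {p : ℕ} {r r' : Fin p → ℝ} (h : ∀ j, 0 ≤ r j)
    (h' : ∀ j, 0 ≤ r' j) (h1 : ∑ j, r j = 1) (h1' : ∑ j, r' j = 1) : ∑ j, √(r j * r' j) ≤ 1 := by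
  have := Real.sum_sqrt_mul_sqrt_le Finset.univ h h'
  rw [h1, h1', Real.sqrt_one, one_mul] at this
  simpa only [Real.sqrt_mul (h _)] using this

/-- The corpus laws have a large common mass if the word laws have affinities close to one. -/
lemma sum_min_corpusProb_ge {p n N : ℕ} {r r' : Fin n → Fin p → ℝ} (h : ∀ i j, 0 ≤ r i j)
    (h' : ∀ i j, 0 ≤ r' i j) (h1 : ∀ i, ∑ j, r i j = 1) (h1' : ∀ i, ∑ j, r' i j = 1)
    (hρ : N * ∑ i, (1 - ∑ j, √(r i j * r' i j)) ≤ 1 / 2) :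
    1 / 8 ≤ ∑ w : Fin n → Fin N → Fin p, min (corpusProb r w) (corpusProb r' w) := by
  refine sum_min_ge (corpusProb_nonneg h) (corpusProb_nonneg h') (by simp [sum_corpusProb, h1])
    (by simp [sum_corpusProb, h1']) ?_
  simp only [sqrt_corpusProb_mul h h', sum_corpusProb]
  have hle : ∀ i, ∑ j, √(r i j * r' i j) ≤ 1 := fun i =>
    sum_sqrt_mul_le_one (h i) (h' i) (h1 i) (h1' i)
  have h0 : ∀ i, 0 ≤ ∑ j, √(r i j * r' i j) := fun i =>
    Finset.sum_nonneg fun j _ => Real.sqrt_nonneg _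
  have hN : ∀ i, 1 - (∑ j, √(r i j * r' i j)) ^ N ≤ N * (1 - ∑ j, √(r i j * r' i j)) := fun i => by
    have := one_sub_sum_le_prod (Finset.range N) (fun _ => h0 i) (fun _ => hle i)
    simp only [Finset.sum_const, Finset.prod_const, Finset.card_range, nsmul_eq_mul] at this
    linarith
  have := one_sub_sum_le_prod Finset.univ (fun i => pow_nonneg (h0 i) N)
    (fun i => pow_le_one₀ (h0 i) (hle i))
  have hs := Finset.sum_le_sum fun i (_ : i ∈ Finset.univ) => hN i
  rw [← Finset.mul_sum] at hs
  linarith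

/-- The deficit is half the sum of `(√r - √r')² = (r - r')² / (√r + √r')²`, and the denominator is
at least `r + r'`. The weight `w` controls both the difference and the sum, so each term is linear
in `w`; words with `w j = 0` contribute nothing. -/
lemma one_sub_affinity_le {p : ℕ} {r r' w : Fin p → ℝ} {g y : ℝ} (h : ∀ j, 0 ≤ r j)
    (h' : ∀ j, 0 ≤ r' j) (h1 : ∑ j, r j = 1) (h1' : ∑ j, r' j = 1)
    (hy : 0 < y) (hw : ∀ j, 0 ≤ w j) (hd : ∀ j, |r j - r' j| ≤ g * w j)
    (hs : ∀ j, y * w j ≤ r j + r' j) :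
    1 - ∑ j, √(r j * r' j) ≤ g ^ 2 * (∑ j, w j) / (2 * y) := by
  have key : ∀ j, (r j + r' j) / 2 - √(r j * r' j) ≤ g ^ 2 * w j / (2 * y) := fun j => by
    rw [Real.sqrt_mul (h j)]
    have ha := Real.sq_sqrt (h j)
    have hb := Real.sq_sqrt (h' j)
    have ha0 := Real.sqrt_nonneg (r j)
    have hb0 := Real.sqrt_nonneg (r' j)
    set a := √(r j)
    set b := √(r' j)
    have hd2 : (r j - r' j) ^ 2 ≤ (g * w j) ^ 2 := sq_le_sq' (by linarith [neg_abs_le (r j - r' j), hd j])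
      ((le_abs_self _).trans (hd j))
    rw [← ha, ← hb] at hd2
    have hsj := hs j
    rw [← ha, ← hb] at hsj ⊢
    rcases (hw j).eq_or_lt with h0 | hpos
    · rw [← h0] at hd2 ⊢
      have h2 : a ^ 2 - b ^ 2 = 0 := by
        have : (a ^ 2 - b ^ 2) ^ 2 = 0 := le_antisymm (by simpa using hd2) (sq_nonneg _)
        exact pow_eq_zero_iff (two_ne_zero) |>.1 this
      have h3 : a = b := by
        have : a ^ 2 = b ^ 2 := by linarith
        exact (sq_eq_sq₀ ha0 hb0).1 this
      rw [h3]; apply le_of_eq; ring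
    · rw [le_div_iff₀ (by positivity)]
      have h4 : (a - b) ^ 2 * (y * w j) ≤ (g * w j) ^ 2 := by
        calc (a - b) ^ 2 * (y * w j) ≤ (a - b) ^ 2 * (a + b) ^ 2 := by
              refine mul_le_mul_of_nonneg_left ?_ (sq_nonneg _)
              nlinarith [mul_nonneg ha0 hb0]
          _ = (a ^ 2 - b ^ 2) ^ 2 := by ring
          _ ≤ _ := hd2
      have h5 : (a - b) ^ 2 * y ≤ g ^ 2 * w j := by
        refine le_of_mul_le_mul_right ?_ hpos
        linarith [h4]
      linarith [h5]
  have hsum := Finset.sum_le_sum fun j (_ : j ∈ Finset.univ) => key j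
  rw [Finset.sum_sub_distrib, ← Finset.sum_div, ← Finset.sum_div, Finset.sum_add_distrib, h1, h1',
    ← Finset.mul_sum] at hsum
  linarith

/-- The reduction of the risk to the separation and the affinities of a family of models indexed by
bit strings. -/
lemma exists_risk_ge {p K n N : ℕ} (d : MetricSpace (Simplex p)) {cd : ℝ} (hcd : 0 < cd)
    (hd : ∀ u v : Simplex p, cd * l1Dist u v ≤ 2 * d.dist u v)
    (est : (Fin n → Fin p → ℕ) → ProbabilityMeasure (MetricSimplex p d)) (i : Fin n)
    {B : Type*} [Fintype B] [DecidableEq B] (A : (B → Bool) → Fin K → Simplex p)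
    (T : (B → Bool) → Fin n → Simplex K) {ε : ℝ} (hε : 0 ≤ ε)
    (hsep : ∀ ω ω', ε * hammingDist ω ω' ≤
      ∑ j, |wordProb (A ω) (T ω i) j - wordProb (A ω') (T ω' i) j|)
    (haff : ∀ ω b, N * ∑ i, (1 - ∑ j, √(wordProb (A ω) (T ω i) j *
      wordProb (A (flipBit b ω)) (T (flipBit b ω) i) j)) ≤ 1 / 2) :
    ∃ ω, ENNReal.ofReal (cd * ε * Fintype.card B / 64) ≤
      ∫⁻ Y, wasserstein (est Y : Measure (MetricSimplex p d)) (mixingMeasure d (A ω) (T ω i))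
        ∂(corpusLaw N (A ω) (T ω)) := by
  let m : (Fin n → Fin N → Fin p) → Fin p → ℝ := fun w =>
    meanVec d (est fun i => wordCount (w i) : Measure (MetricSimplex p d))
  let r : (B → Bool) → Fin p → ℝ := fun ω => wordProb (A ω) (T ω i)
  let P : (B → Bool) → (Fin n → Fin N → Fin p) → ℝ := fun ω =>
    corpusProb fun i => wordProb (A ω) (T ω i)
  have hP : ∀ ω w, 0 ≤ P ω w := fun ω w => corpusProb_nonneg (fun _ _ => wordProb_nonneg _ _ _) w
  -- Minimum distance decoding: the estimator is replaced by the cube vertex nearest to its mean, at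
  -- the cost of a factor `2` by the triangle inequality.
  choose est' hest' using fun w => Finite.exists_min fun ω => ∑ j, |m w j - r ω j|
  obtain ⟨ω, hω⟩ := assouad P (1 / 8) (fun ω b => sum_min_corpusProb_ge
    (fun _ _ => wordProb_nonneg _ _ _) (fun _ _ => wordProb_nonneg _ _ _)
    (fun _ => sum_wordProb _ _) (fun _ => sum_wordProb _ _) (haff ω b)) est'
  refine ⟨ω, ?_⟩
  have hloss : ∀ w, cd / 4 * ε * hammingDist (est' w) ω ≤ cd / 2 * ∑ j, |m w j - r ω j| :=
    fun w => by
      have h1 : ∑ j, |r (est' w) j - r ω j| ≤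
          ∑ j, |m w j - r (est' w) j| + ∑ j, |m w j - r ω j| := by
        rw [← Finset.sum_add_distrib]
        refine Finset.sum_le_sum fun j _ => ?_
        rw [abs_sub_comm (m w j) (r (est' w) j)]
        exact abs_sub_le _ _ _
      have h2 := hest' w ω
      have h3 := hsep (est' w) ω
      have h4 : ε * hammingDist (est' w) ω ≤ 2 * ∑ j, |m w j - r ω j| := by
        change _ ≤ ∑ j, |r (est' w) j - r ω j| at h3
        linarith
      nlinarith
  rw [lintegral_corpusLaw]
  calc ENNReal.ofReal (cd * ε * Fintype.card B / 64)
      ≤ ENNReal.ofReal (∑ w, (cd / 2 * ∑ j, |m w j - r ω j|) * P ω w) := by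
        refine ENNReal.ofReal_le_ofReal ?_
        calc cd * ε * Fintype.card B / 64 = cd / 4 * ε * (1 / 8 * Fintype.card B / 2) := by ring
          _ ≤ cd / 4 * ε * ∑ w, P ω w * hammingDist (est' w) ω := by gcongr
          _ = ∑ w, (cd / 4 * ε * hammingDist (est' w) ω) * P ω w := by
            rw [Finset.mul_sum]; exact Finset.sum_congr rfl fun w _ => by ring
          _ ≤ _ := Finset.sum_le_sum fun w _ => mul_le_mul_of_nonneg_right (hloss w) (hP ω w)
    _ = ∑ w, ENNReal.ofReal (cd / 2 * ∑ j, |m w j - r ω j|) * ENNReal.ofReal (P ω w) := by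
        have h0 : ∀ w, 0 ≤ cd / 2 * ∑ j, |m w j - r ω j| := fun w =>
          mul_nonneg (by positivity) (Finset.sum_nonneg fun j _ => abs_nonneg _)
        rw [ENNReal.ofReal_sum_of_nonneg fun w _ => mul_nonneg (h0 w) (hP ω w)]
        exact Finset.sum_congr rfl fun w _ => ENNReal.ofReal_mul (h0 w)
    _ ≤ _ := by
        refine Finset.sum_le_sum fun w _ => mul_le_mul_left ?_ _
        have h := wasserstein_ge d hcd hd
          (est fun i => wordCount (w i) : Measure (MetricSimplex p d))
          (mixingMeasure d (A ω) (T ω i))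
        simpa only [meanVec_mixingMeasure d hcd hd] using h

/-! ### Perturbations of a point of the simplex -/

/-- The sign of a bit. -/
def bitSign (b : Bool) : ℝ := if b then 1 else -1

lemma abs_bitSign (b : Bool) : |bitSign b| = 1 := by cases b <;> simp [bitSign]

lemma bitSign_le_one (b : Bool) : bitSign b ≤ 1 := by cases b <;> simp [bitSign]

lemma neg_one_le_bitSign (b : Bool) : -1 ≤ bitSign b := by cases b <;> simp [bitSign]

lemma bitSign_not (b : Bool) : bitSign (!b) = -bitSign b := by cases b <;> simp [bitSign]

/-- The coordinates in `J` of the point `β` can be shifted by `± g` and still be positive, with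
coordinate `o` balancing the sum. -/
structure Perturbable {m : ℕ} (β : Simplex m) (J : Finset (Fin m)) (o : Fin m) (g : ℝ) : Prop where
  notMem : o ∉ J
  nonneg : 0 ≤ g
  le : ∀ b ∈ J, 2 * g ≤ β b
  le_balance : 2 * (J.card * g) ≤ β o

/-- The vector with entry `1` at `b` and `-1` at `o`. -/
def exchange {m : ℕ} (o b k : Fin m) : ℝ := (if k = b then 1 else 0) - if k = o then 1 else 0

lemma sum_exchange_mul {m : ℕ} (o b : Fin m) (f : Fin m → ℝ) :
    ∑ k, f k * exchange o b k = f b - f o := by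
  simp [exchange, mul_sub, Finset.sum_sub_distrib]

lemma sum_exchange {m : ℕ} (o b : Fin m) : ∑ k, exchange o b k = 0 := by
  simpa using sum_exchange_mul o b 1

/-- The coordinates of a perturbed point. -/
def perturbFun {m : ℕ} (β : Fin m → ℝ) (J : Finset (Fin m)) (o : Fin m) (g : ℝ) (ω : J → Bool)
    (k : Fin m) : ℝ :=
  β k + g * ∑ b : J, bitSign (ω b) * exchange o b k

lemma perturbFun_mem {m : ℕ} (β : Fin m → ℝ) {J : Finset (Fin m)} {o : Fin m} (ho : o ∉ J) (g : ℝ)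
    (ω : J → Bool) (b : J) : perturbFun β J o g ω b = β b + g * bitSign (ω b) := by
  have hb : (b : Fin m) ≠ o := fun h => ho (h ▸ b.2)
  have h : ∀ b' : J, (b : Fin m) = b' ↔ b = b' := fun b' => Subtype.ext_iff.symm
  simp [perturbFun, exchange, hb, h]

lemma perturbFun_balance {m : ℕ} (β : Fin m → ℝ) {J : Finset (Fin m)} {o : Fin m} (ho : o ∉ J)
    (g : ℝ) (ω : J → Bool) : perturbFun β J o g ω o = β o - g * ∑ b : J, bitSign (ω b) := by
  have h : ∀ b : J, o ≠ b := fun b h => ho (h ▸ b.2)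
  simp [perturbFun, exchange, h, sub_eq_add_neg]

lemma perturbFun_of_ne {m : ℕ} (β : Fin m → ℝ) {J : Finset (Fin m)} {o k : Fin m} (hk : k ∉ J)
    (hko : k ≠ o) (g : ℝ) (ω : J → Bool) : perturbFun β J o g ω k = β k := by
  have h : ∀ b : J, k ≠ b := fun b h => hk (h ▸ b.2)
  simp [perturbFun, exchange, h, hko]

/-- This is the purpose of the factors `2` in `Perturbable`: two perturbed points together dominate
`β`, which gives the denominators of the affinity bounds. -/
lemma Perturbable.half_le {m : ℕ} {β : Simplex m} {J : Finset (Fin m)} {o : Fin m} {g : ℝ}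
    (h : Perturbable β J o g) (ω : J → Bool) (k : Fin m) : β k / 2 ≤ perturbFun β J o g ω k := by
  by_cases hk : k ∈ J
  · have h1 := perturbFun_mem β h.notMem g ω ⟨k, hk⟩
    change perturbFun β J o g ω k = β k + _ at h1
    rw [h1]
    nlinarith [h.le k hk, h.nonneg, neg_one_le_bitSign (ω ⟨k, hk⟩)]
  · by_cases hko : k = o
    · subst hko
      rw [perturbFun_balance β h.notMem]
      have h2 : ∑ b : J, bitSign (ω b) ≤ J.card := by
        simpa using Finset.sum_le_sum fun b (_ : b ∈ Finset.univ) => bitSign_le_one (ω b)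
      nlinarith [h.le_balance, h.nonneg, mul_le_mul_of_nonneg_left h2 h.nonneg]
    · rw [perturbFun_of_ne β hk hko]
      linarith [simplex_nonneg β k]

lemma sum_perturbFun {m : ℕ} (β : Fin m → ℝ) (J : Finset (Fin m)) (o : Fin m) (g : ℝ)
    (ω : J → Bool) : ∑ k, perturbFun β J o g ω k = ∑ k, β k := by
  unfold perturbFun
  rw [Finset.sum_add_distrib, ← Finset.mul_sum, Finset.sum_comm]
  simp only [← Finset.mul_sum, sum_exchange]
  simp

/-- The perturbed point. -/
def Perturbable.point {m : ℕ} {β : Simplex m} {J : Finset (Fin m)} {o : Fin m} {g : ℝ}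
    (h : Perturbable β J o g) (ω : J → Bool) : Simplex m :=
  ⟨perturbFun β J o g ω, fun k =>
    (div_nonneg (simplex_nonneg β k) two_pos.le).trans (h.half_le ω k),
    (sum_perturbFun β J o g ω).trans (sum_simplex β)⟩

lemma Perturbable.point_apply {m : ℕ} {β : Simplex m} {J : Finset (Fin m)} {o : Fin m} {g : ℝ}
    (h : Perturbable β J o g) (ω : J → Bool) (k : Fin m) :
    h.point ω k = perturbFun β J o g ω k := rfl

lemma Perturbable.half_le_point {m : ℕ} {β : Simplex m} {J : Finset (Fin m)} {o : Fin m} {g : ℝ}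
    (h : Perturbable β J o g) (ω : J → Bool) (k : Fin m) : β k / 2 ≤ h.point ω k :=
  h.half_le ω k

lemma Perturbable.point_sub_flip {m : ℕ} {β : Simplex m} {J : Finset (Fin m)} {o : Fin m} {g : ℝ}
    (h : Perturbable β J o g) (ω : J → Bool) (b : J) (k : Fin m) :
    h.point ω k - h.point (flipBit b ω) k = 2 * g * bitSign (ω b) * exchange o b k := by
  have e : ∑ b' : J, bitSign (ω b') * exchange o b' k -
      ∑ b' : J, bitSign (flipBit b ω b') * exchange o b' k =
      2 * bitSign (ω b) * exchange o b k := by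
    rw [← Finset.sum_sub_distrib, Finset.sum_eq_single b]
    · rw [flipBit_self, bitSign_not]; ring
    · intro b' _ hb'
      rw [flipBit_of_ne hb', sub_self]
    · simp
  rw [h.point_apply, h.point_apply, perturbFun, perturbFun]
  linear_combination g * e

lemma Perturbable.hammingDist_le {m : ℕ} {β : Simplex m} {J : Finset (Fin m)} {o : Fin m} {g : ℝ}
    (h : Perturbable β J o g) (ω ω' : J → Bool) :
    2 * g * hammingDist ω ω' ≤ ∑ k, |h.point ω k - h.point ω' k| := by
  have h1 : ∑ b : J, |h.point ω b - h.point ω' b| ≤ ∑ k, |h.point ω k - h.point ω' k| := by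
    rw [Finset.sum_coe_sort J fun k => |h.point ω k - h.point ω' k|]
    exact Finset.sum_le_sum_of_subset_of_nonneg (Finset.subset_univ _) fun _ _ _ => abs_nonneg _
  refine le_trans (le_of_eq ?_) h1
  rw [hammingDist, Finset.cast_card, Finset.sum_filter, Finset.mul_sum]
  refine Finset.sum_congr rfl fun b _ => ?_
  rw [h.point_apply, h.point_apply, perturbFun_mem β h.notMem, perturbFun_mem β h.notMem,
    add_sub_add_left_eq_sub, ← mul_sub, abs_mul, abs_of_nonneg h.nonneg]
  cases ω b <;> cases ω' b <;> norm_num [bitSign] <;> ring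

lemma Perturbable.point_eq_zero {m : ℕ} {β : Simplex m} {J : Finset (Fin m)} {o : Fin m} {g : ℝ}
    (h : Perturbable β J o g) (ω : J → Bool) {k : Fin m} (hk : k ∉ J) (hko : k ≠ o)
    (h0 : β k = 0) : h.point ω k = 0 := by
  rw [h.point_apply, perturbFun_of_ne β hk hko, h0]

/-! ### The rank condition -/

lemma rank_eq_iff {K n : ℕ} (M : Matrix (Fin K) (Fin n) ℝ) :
    M.rank = K ↔ ∀ x : Fin K → ℝ, (∀ i, ∑ k, x k * M k i = 0) → x = 0 := by
  have h1 : M.rank = K ↔ LinearIndependent ℝ M.row := by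
    rw [Matrix.rank_eq_finrank_span_row, linearIndependent_iff_card_eq_finrank_span,
      Fintype.card_fin, eq_comm]
    rfl
  rw [h1, ← Matrix.vecMul_injective_iff]
  constructor
  · intro h x hx
    refine h ?_
    simp only [Matrix.zero_vecMul]
    ext i
    simpa [Matrix.vecMul, dotProduct] using hx i
  · intro h x y hxy
    refine sub_eq_zero.1 (h _ fun i => ?_)
    have := congrFun hxy i
    simp only [Matrix.vecMul, dotProduct] at this
    simp only [Pi.sub_apply, sub_mul, Finset.sum_sub_distrib, this, sub_self]

/-- If some weights satisfy the rank condition, then all weights off a hyperplane do. -/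
lemma exists_functional {K n τ : ℕ} {i : Fin n} {T : Fin n → Simplex K}
    (hne : (admissibleWeights τ i T).Nonempty) :
    ∃ h : Fin K → ℝ, (∃ l, h l ≠ 0) ∧ ∀ α ∈ sparseWeights K τ, ∑ k, h k * α k ≠ 0 →
      α ∈ admissibleWeights τ i T := by
  obtain ⟨α₀, -, h₀⟩ := hne
  rw [rank_eq_iff] at h₀
  have key : ∀ (α : Simplex K) (x : Fin K → ℝ), (∀ i', i' ≠ i → ∑ k, x k * T i' k = 0) →
      ∑ k, x k * α k = 0 → ∀ i', ∑ k, x k * (Matrix.of fun (k : Fin K) (i' : Fin n) =>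
        Function.update T i α i' k) k i' = 0 := fun α x hx hxα i' => by
    by_cases hi : i' = i
    · subst hi; simpa using hxα
    · simpa [hi] using hx i' hi
  have key' : ∀ (α : Simplex K) (x : Fin K → ℝ), (∀ i', ∑ k, x k * (Matrix.of fun (k : Fin K)
      (i' : Fin n) => Function.update T i α i' k) k i' = 0) →
      (∀ i', i' ≠ i → ∑ k, x k * T i' k = 0) ∧ ∑ k, x k * α k = 0 := fun α x hx =>
    ⟨fun i' hi => by simpa [hi] using hx i', by simpa using hx i⟩
  -- The question is whether the other documents already have rank `K`. If not, the functionals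
  -- vanishing on them form a line, because `α₀` completes the rank.
  by_cases hU : ∃ x : Fin K → ℝ, x ≠ 0 ∧ ∀ i', i' ≠ i → ∑ k, x k * T i' k = 0
  · obtain ⟨h, hh, hhT⟩ := hU
    refine ⟨h, Function.ne_iff.1 hh, fun α hα hne => ⟨hα, ?_⟩⟩
    have hα₀ : ∑ k, h k * α₀ k ≠ 0 := fun h0 => hh (h₀ h (key _ _ hhT h0))
    rw [rank_eq_iff]
    intro x hx
    obtain ⟨hx1, hx2⟩ := key' _ _ hx
    -- With this `c`, the functional `x - c • h` vanishes on the other documents and at `α₀`, so it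
    -- is zero; evaluating it at `α` gives `c = 0`.
    set c := (∑ k, x k * α₀ k) / ∑ k, h k * α₀ k with hc
    have hlin : ∀ f : Fin K → ℝ, ∑ k, (x - c • h) k * f k =
        ∑ k, x k * f k - c * ∑ k, h k * f k := fun f => by
      rw [Finset.mul_sum, ← Finset.sum_sub_distrib]
      exact Finset.sum_congr rfl fun k _ => by simp; ring
    have h2 : x - c • h = 0 := h₀ _ (key _ _ (fun i' hi => by
      rw [hlin, hx1 i' hi, hhT i' hi]; simp) (by
      rw [hlin, hc, div_mul_cancel₀ _ hα₀, sub_self]))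
    have h3 := hlin α
    rw [h2, hx2] at h3
    simp only [Pi.zero_apply, zero_mul, Finset.sum_const_zero, zero_sub, zero_eq_neg, mul_eq_zero,
      hne, or_false] at h3
    rw [h3, zero_smul, sub_zero] at h2
    exact h2
  · push Not at hU
    have hK : Nonempty (Fin K) := by
      by_contra hK
      rw [not_nonempty_iff] at hK
      simpa using sum_simplex α₀
    refine ⟨1, ⟨hK.some, one_ne_zero⟩, fun α hα _ => ⟨hα, ?_⟩⟩
    rw [rank_eq_iff]
    intro x hx
    by_contra hx0
    obtain ⟨i', hi, hne⟩ := hU x hx0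
    exact hne ((key' _ _ hx).1 i' hi)

/-! ### Estimating sparse weights -/

/-- Assouad's lower bound for the minimax risk. -/
lemma le_minimaxRisk {p K n N τ : ℕ} {d : MetricSpace (Simplex p)} {cA cm cd : ℝ} (hcd : 0 < cd)
    (hd : ∀ u v : Simplex p, cd * l1Dist u v ≤ 2 * d.dist u v) {i : Fin n} {T : Fin n → Simplex K}
    {B : Type*} [Fintype B] [DecidableEq B] {A : (B → Bool) → Fin K → Simplex p}
    {α : (B → Bool) → Simplex K} (hA : ∀ ω, A ω ∈ topicMatrices p K cA cm)
    (hα : ∀ ω, α ω ∈ admissibleWeights τ i T) {ε : ℝ} (hε : 0 ≤ ε)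
    (hsep : ∀ ω ω', ε * hammingDist ω ω' ≤
      ∑ j, |wordProb (A ω) (α ω) j - wordProb (A ω') (α ω') j|)
    (haff : ∀ ω b, N * ∑ i', (1 - ∑ j, √(wordProb (A ω) (Function.update T i (α ω) i') j *
      wordProb (A (flipBit b ω)) (Function.update T i (α (flipBit b ω)) i') j)) ≤ 1 / 2) :
    ENNReal.ofReal (cd * ε * Fintype.card B / 64) ≤ minimaxRisk d cA cm N τ i T := by
  refine le_iInf fun est => ?_
  obtain ⟨ω, hω⟩ := exists_risk_ge d hcd hd est i A (fun ω => Function.update T i (α ω)) hε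
    (by simpa using hsep) haff
  refine hω.trans (le_iSup₂_of_le (α ω) (hα ω) (le_iSup₂_of_le (A ω) (hA ω) ?_))
  simp

lemma condNumber_nonneg {p K : ℕ} (A : Fin K → Simplex p) (J : Finset (Fin p)) (s : ℕ) :
    0 ≤ condNumber A J s := by
  refine Real.sInf_nonneg ?_
  rintro x ⟨S, -, v, -, -, rfl⟩
  positivity

lemma kappaBar_nonneg {p K : ℕ} (A : Fin K → Simplex p) (τ : ℕ) : 0 ≤ kappaBar A τ := by
  refine Real.sInf_nonneg ?_
  rintro x ⟨α, -, rfl⟩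
  exact condNumber_nonneg _ _ _

/-- With `S = supp α` the cone condition is automatic, since `v` vanishes off `S`; enlarging the
word set to all words only increases the right-hand side. -/
lemma kappaBar_mul_le {p K τ : ℕ} (A : Fin K → Simplex p) {α : Simplex K}
    (hα : α ∈ sparseWeights K τ) {v : Fin K → ℝ} (hv : ∀ k, α k = 0 → v k = 0) :
    kappaBar A τ * ∑ k, |v k| ≤ ∑ j, |∑ k, A k j * v k| := by
  by_cases hv0 : v = 0
  · simp [hv0]
  have hpos : 0 < ∑ k, |v k| := by
    obtain ⟨k, hk⟩ := Function.ne_iff.1 hv0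
    exact Finset.sum_pos' (fun k _ => abs_nonneg _) ⟨k, Finset.mem_univ k, abs_pos.2 hk⟩
  have h1 : kappaBar A τ ≤ condNumber A (wordSupp A α) (supp α).card := by
    refine csInf_le ⟨0, ?_⟩ ⟨α, hα, rfl⟩
    rintro x ⟨α, -, rfl⟩
    exact condNumber_nonneg _ _ _
  have h2 : condNumber A (wordSupp A α) (supp α).card ≤
      (∑ j ∈ wordSupp A α, |∑ k, A k j * v k|) / ∑ k, |v k| := by
    refine csInf_le ⟨0, ?_⟩ ⟨supp α, le_rfl, v, hv0, ?_, rfl⟩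
    · rintro x ⟨S, -, v, -, -, rfl⟩
      positivity
    · rw [Finset.sum_eq_zero fun k hk => ?_]
      · positivity
      · rw [hv k (by simpa [supp] using hk), abs_zero]
  have h3 := (le_div_iff₀ hpos).1 (h1.trans h2)
  exact h3.trans (Finset.sum_le_sum_of_subset_of_nonneg (Finset.subset_univ _)
    fun _ _ _ => abs_nonneg _)

lemma wordProb_sub {p K : ℕ} (A : Fin K → Simplex p) (α α' : Simplex K) (j : Fin p) :
    wordProb A α j - wordProb A α' j = ∑ k, A k j * (α k - α' k) := by
  simp only [wordProb, mul_sub, Finset.sum_sub_distrib]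

lemma Perturbable.kappaBar_mul_le {p K τ : ℕ} (A : Fin K → Simplex p) {β : Simplex K}
    {J : Finset (Fin K)} {o : Fin K} {g : ℝ} (h : Perturbable β J o g)
    (hs : ∀ ω, h.point ω ∈ sparseWeights K τ) (hJ : ∀ b ∈ J, 0 < β b) (ho : 0 < β o)
    (ω ω' : J → Bool) :
    kappaBar A τ * (2 * g) * hammingDist ω ω' ≤
      ∑ j, |wordProb A (h.point ω) j - wordProb A (h.point ω') j| := by
  simp only [wordProb_sub]
  refine le_trans ?_ (TopicModel.kappaBar_mul_le A (hs ω) (v := fun k => h.point ω k - h.point ω' k) ?_)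
  · rw [mul_assoc]
    exact mul_le_mul_of_nonneg_left (h.hammingDist_le ω ω') (kappaBar_nonneg A τ)
  · intro k hk
    have h0 := h.half_le_point ω k
    have hkJ : k ∉ J := fun hkJ => by linarith [hJ k hkJ]
    have hko : k ≠ o := fun hko => by subst hko; linarith
    rw [h.point_apply, h.point_apply, perturbFun_of_ne _ hkJ hko, perturbFun_of_ne _ hkJ hko,
      sub_self]

/-- A flip moves mass between the topics `b` and `o` only. The difference is thus at most `2 * g *
(A b + A o)`, while both topics carry weight at least `x` in `β`, so that the sum dominates `x * (A
b + A o)`. -/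
lemma Perturbable.one_sub_affinity_weights_le {p K : ℕ} (A : Fin K → Simplex p) {β : Simplex K}
    {J : Finset (Fin K)} {o : Fin K} {g x : ℝ} (h : Perturbable β J o g) (hx : 0 < x)
    (hJ : ∀ b ∈ J, x ≤ β b) (ho : x ≤ β o) (ω : J → Bool) (b : J) :
    1 - ∑ j, √(wordProb A (h.point ω) j * wordProb A (h.point (flipBit b ω)) j) ≤
      4 * g ^ 2 / x := by
  have hbo : (b : Fin K) ≠ o := fun e => h.notMem (e ▸ b.2)
  refine (one_sub_affinity_le (w := fun j => A b j + A o j) (g := 2 * g) (y := x)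
    (wordProb_nonneg A _) (wordProb_nonneg A _) (sum_wordProb A _) (sum_wordProb A _) hx
    (fun j => add_nonneg (simplex_nonneg _ j) (simplex_nonneg _ j)) (fun j => ?_)
    (fun j => ?_)).trans (le_of_eq ?_)
  · have e : wordProb A (h.point ω) j - wordProb A (h.point (flipBit b ω)) j =
        2 * g * bitSign (ω b) * (A b j - A o j) := by
      rw [wordProb_sub, ← sum_exchange_mul o b fun k => A k j, Finset.mul_sum]
      refine Finset.sum_congr rfl fun k _ => ?_
      rw [h.point_sub_flip]; ring
    rw [e, abs_mul, abs_mul, abs_bitSign, mul_one, abs_of_nonneg (by linarith [h.nonneg])]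
    refine mul_le_mul_of_nonneg_left ?_ (by linarith [h.nonneg])
    rw [abs_le]
    constructor <;> linarith [simplex_nonneg (A b) j, simplex_nonneg (A o) j]
  · have h1 : ∑ k, A k j * β k ≤
        wordProb A (h.point ω) j + wordProb A (h.point (flipBit b ω)) j := by
      rw [wordProb, wordProb, ← Finset.sum_add_distrib]
      refine Finset.sum_le_sum fun k _ => ?_
      rw [← mul_add]
      exact mul_le_mul_of_nonneg_left
        (by linarith [h.half_le_point ω k, h.half_le_point (flipBit b ω) k]) (simplex_nonneg _ j)
    refine le_trans ?_ h1
    refine le_trans ?_ (Finset.sum_le_sum_of_subset_of_nonneg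
      (Finset.subset_univ {(b : Fin K), o}) fun k _ _ =>
        mul_nonneg (simplex_nonneg (A k) j) (simplex_nonneg β k))
    rw [Finset.sum_pair hbo]
    nlinarith [mul_le_mul_of_nonneg_left (hJ b b.2) (simplex_nonneg (A b) j),
      mul_le_mul_of_nonneg_left ho (simplex_nonneg (A o) j)]
  · rw [Finset.sum_add_distrib, sum_simplex, sum_simplex]
    field_simp
    ring

/-- The weights with mass `1 - t` at `o` and the mass `t` uniformly distributed over `J`. -/
def twoLevel {m : ℕ} (J : Finset (Fin m)) (hJ : J.Nonempty) (o : Fin m) {t : ℝ} (h0 : 0 ≤ t)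
    (h1 : t ≤ 1) : Simplex m :=
  ⟨fun k => (if k = o then 1 - t else 0) + if k ∈ J then t / J.card else 0,
    fun k => add_nonneg (by split_ifs <;> linarith) (by split_ifs <;> positivity), by
    have : (J.card : ℝ) ≠ 0 := by simpa using hJ.ne_empty
    simp [Finset.sum_add_distrib]
    field_simp
    ring⟩

lemma twoLevel_apply {m : ℕ} (J : Finset (Fin m)) (hJ : J.Nonempty) (o : Fin m) {t : ℝ}
    (h0 : 0 ≤ t) (h1 : t ≤ 1) (k : Fin m) : twoLevel J hJ o h0 h1 k =
      (if k = o then 1 - t else 0) + if k ∈ J then t / J.card else 0 := rfl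

lemma exists_forall_add_mul_ne_zero {ι : Type*} [Fintype ι] {a : ℝ} (ha : a ≠ 0) (c : ι → ℝ)
    {u v : ℝ} (huv : u < v) : ∃ t ∈ Set.Icc u v, ∀ ι, a + t * c ι ≠ 0 := by
  classical
  obtain ⟨t, ht, hn⟩ := (Set.Icc_infinite huv).exists_notMem_finset
    (Finset.univ.image fun ι => -a / c ι)
  refine ⟨t, ht, fun ι h => hn (Finset.mem_image.2 ⟨ι, Finset.mem_univ ι, ?_⟩)⟩
  have hc : c ι ≠ 0 := fun hc => ha (by simpa [hc] using h)
  rw [div_eq_iff hc]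
  linarith

lemma weights_lower_bound {p K n N τ : ℕ} {d : MetricSpace (Simplex p)} {cA cm cd c : ℝ}
    (hcd : 0 < cd) (hd : ∀ u v : Simplex p, cd * l1Dist u v ≤ 2 * d.dist u v) {i : Fin n}
    {T : Fin n → Simplex K} (hc : 0 < c) (hτ : 1 < τ) (hτK : τ ≤ K) (hτN : (τ : ℝ) ≤ c * N)
    (hne : (admissibleWeights τ i T).Nonempty) {A : Fin K → Simplex p}
    (hA : A ∈ topicMatrices p K cA cm) :
    ENNReal.ofReal (1 / (128 * (2 * √c + 3)) * cd * (kappaBar A τ * √(τ / N))) ≤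
      minimaxRisk d cA cm N τ i T := by
  have hN : (0 : ℝ) < N := by
    have : (0 : ℝ) < c * N := lt_of_lt_of_le (by exact_mod_cast (zero_lt_one.trans hτ)) hτN
    exact pos_of_mul_pos_right this hc.le
  have hτ' : (2 : ℝ) ≤ τ := by exact_mod_cast hτ
  obtain ⟨h, ⟨l, hl⟩, hadm⟩ := exists_functional hne
  -- The balancing topic is `l`, where `h l ≠ 0`; it and `τ - 1` further topics exhaust the
  -- sparsity.
  obtain ⟨J, hJs, hJc⟩ := Finset.exists_subset_card_eq
    (s := Finset.univ.erase l) (n := τ - 1) (by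
      rw [Finset.card_erase_of_mem (Finset.mem_univ l), Finset.card_univ, Fintype.card_fin]; omega)
  have hlJ : l ∉ J := fun hmem => by simpa using hJs hmem
  have hJm : (J.card : ℝ) = τ - 1 := by rw [hJc, Nat.cast_sub hτ.le, Nat.cast_one]
  have hJpos : (1 : ℝ) ≤ J.card := by rw [hJm]; linarith
  have hJne : J.Nonempty := Finset.card_pos.1 (by omega)
  -- The relative size of the perturbation. The denominator ensures `δ ≤ 1 / 2`, via `τ ≤ c * N`,
  -- and `δ² ≤ τ / (8 N)`.
  set δ : ℝ := 1 / (2 * √c + 3) * √(τ / N) with hδ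
  have hc0 := Real.sqrt_nonneg c
  have hδ0 : 0 ≤ δ := by positivity
  have hs : √(τ / N) ≤ √c := Real.sqrt_le_sqrt ((div_le_iff₀ hN).2 hτN)
  have hδ1 : δ ≤ 1 / 2 := by
    rw [hδ, one_div_mul_eq_div, div_le_iff₀ (by positivity)]
    linarith
  have hδ2 : δ ^ 2 ≤ τ / N / 8 := by
    rw [hδ, mul_pow, Real.sq_sqrt (by positivity)]
    have : (1 / (2 * √c + 3)) ^ 2 ≤ 1 / 8 := by
      rw [div_pow, one_pow]
      exact one_div_le_one_div_of_le (by norm_num) (by nlinarith)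
    calc _ ≤ 1 / 8 * ((τ : ℝ) / N) := by gcongr
      _ = _ := by ring
  -- At each vertex the value of `h` is affine in `t` with constant term `h l ≠ 0`, so finitely many
  -- `t` are bad and one `t` serves all vertices.
  obtain ⟨t, ⟨ht0, ht1⟩, ht⟩ := exists_forall_add_mul_ne_zero hl (fun ω : J → Bool =>
    -h l + (∑ b ∈ J, h b) / J.card + δ / J.card * ∑ b : J, bitSign (ω b) * (h b - h l))
    (by norm_num : (1 / 4 : ℝ) < 1 / 2)
  set β := twoLevel J hJne l (by linarith : 0 ≤ t) (by linarith) with hβ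
  have hx0 : 0 < t / J.card := by positivity
  have hβJ : ∀ b ∈ J, β b = t / J.card := fun b hb => by
    have : b ≠ l := fun e => hlJ (e ▸ hb)
    simp [hβ, twoLevel_apply, hb, this]
  have hβl : β l = 1 - t := by simp [hβ, twoLevel_apply, hlJ]
  have hxl : t / J.card ≤ β l := by
    rw [hβl]
    calc t / J.card ≤ t := div_le_self (by linarith) hJpos
      _ ≤ 1 - t := by linarith
  have hpert : Perturbable β J l (δ * (t / J.card)) :=
    { notMem := hlJ
      nonneg := by positivity
      le := fun b hb => by rw [hβJ b hb]; nlinarith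
      le_balance := by
        rw [hβl]
        have : (J.card : ℝ) * (δ * (t / J.card)) = δ * t := by field_simp
        rw [this]
        nlinarith }
  have hfun : ∀ ω, ∑ k, h k * hpert.point ω k = h l + t *
      (-h l + (∑ b ∈ J, h b) / J.card + δ / J.card * ∑ b : J, bitSign (ω b) * (h b - h l)) :=
    fun ω => by
      have e1 : ∑ k, h k * β k = (1 - t) * h l + t / J.card * ∑ b ∈ J, h b := by
        simp only [hβ, twoLevel_apply, mul_add, Finset.sum_add_distrib, mul_ite, mul_zero,
          Finset.sum_ite_eq', Finset.mem_univ, if_true, ← Finset.sum_filter,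
          ← Finset.sum_mul, Finset.filter_mem_eq_inter, Finset.univ_inter]
        ring
      have e2 : ∑ k, h k * ∑ b : J, bitSign (ω b) * exchange l b k =
          ∑ b : J, bitSign (ω b) * (h b - h l) := by
        simp only [← sum_exchange_mul l _ h, Finset.mul_sum]
        rw [Finset.sum_comm]
        exact Finset.sum_congr rfl fun b _ => Finset.sum_congr rfl fun k _ => by ring
      have e3 : ∑ k, h k * hpert.point ω k = ∑ k, h k * β k + δ * (t / J.card) *
          ∑ k, h k * ∑ b : J, bitSign (ω b) * exchange l b k := by
        rw [Finset.mul_sum, ← Finset.sum_add_distrib]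
        refine Finset.sum_congr rfl fun k _ => ?_
        rw [hpert.point_apply, perturbFun]; ring
      rw [e3, e1, e2]
      ring
  have hsparse : ∀ ω, hpert.point ω ∈ sparseWeights K τ := fun ω => by
    have hsub : supp (hpert.point ω) ⊆ insert l J := fun k hk => by
      by_contra hk'
      rw [Finset.mem_insert, not_or] at hk'
      refine (Finset.mem_filter.1 hk).2 (hpert.point_eq_zero ω hk'.2 hk'.1 ?_)
      simp [hβ, twoLevel_apply, hk'.1, hk'.2]
    have := (Finset.card_le_card hsub).trans (Finset.card_insert_le l J)
    change (supp (hpert.point ω)).card ≤ τ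
    omega
  have hκ := kappaBar_nonneg A τ
  have hmain := le_minimaxRisk (N := N) (A := fun _ => A) (α := hpert.point) hcd hd (fun _ => hA)
    (fun ω => hadm _ (hsparse ω) (by rw [hfun]; exact ht ω))
    (ε := kappaBar A τ * (2 * (δ * (t / J.card)))) (by positivity)
    (hpert.kappaBar_mul_le A hsparse (fun b hb => by rw [hβJ b hb]; exact hx0)
      (hx0.trans_le hxl)) (fun ω b => ?_)
  · refine (ENNReal.ofReal_le_ofReal ?_).trans hmain
    rw [Fintype.card_coe]
    have e : cd * (kappaBar A τ * (2 * (δ * (t / J.card)))) * J.card / 64 =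
        t / 32 * (cd * kappaBar A τ * δ) := by field_simp; ring
    have e' : 1 / (128 * (2 * √c + 3)) * cd * (kappaBar A τ * √(τ / N)) =
        1 / 128 * (cd * kappaBar A τ * δ) := by rw [hδ]; field_simp
    rw [e, e']
    exact mul_le_mul_of_nonneg_right (by linarith) (by positivity)
  · rw [Finset.sum_eq_single i]
    · simp only [Function.update_self]
      have h1 := hpert.one_sub_affinity_weights_le A hx0 (fun b hb => (hβJ b hb).ge) hxl ω b
      have h2 : 4 * (δ * (t / J.card)) ^ 2 / (t / J.card) = 4 * δ ^ 2 * t / J.card := by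
        field_simp
      rw [h2] at h1
      calc _ ≤ N * (4 * δ ^ 2 * t / J.card) := by gcongr
        _ ≤ N * (4 * (τ / N / 8) * (1 / 2) / (τ / 2)) := by
          gcongr
          rw [hJm]; linarith
        _ = 1 / 2 := by field_simp; norm_num
    · intro i' _ hi'
      simp only [Function.update_of_ne hi', Real.sqrt_mul_self (wordProb_nonneg A _ _),
        sum_wordProb, sub_self]
    · simp

/-! ### Estimating the topics -/

lemma exists_le_of_topicMatrices {p K : ℕ} {cA cm : ℝ} (hcA : 0 < cA) {A : Fin K → Simplex p}
    (hA : A ∈ topicMatrices p K cA cm) (j : Fin p) : ∃ k, cA / p ≤ A k j := by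
  have hp : (0 : ℝ) < p := by exact_mod_cast j.pos
  by_contra! hlt
  refine (hA.1 j).not_gt ((pi_norm_lt_iff (by positivity)).2 fun k => ?_)
  rw [Real.norm_eq_abs, abs_of_nonneg (simplex_nonneg _ _)]
  exact hlt k

/-- A word that occurs in one topic only is an anchor word. -/
lemma isAnchor_of_forall_eq_zero {p K : ℕ} {cA cm : ℝ} (hcA : 0 < cA) {A : Fin K → Simplex p}
    (hA : A ∈ topicMatrices p K cA cm) {j : Fin p} {k : Fin K} (h : ∀ k', k' ≠ k → A k' j = 0) :
    IsAnchor A j k ∧ cA / p ≤ A k j := by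
  have hp : (0 : ℝ) < p := by exact_mod_cast j.pos
  have hpos : 0 < cA / p := by positivity
  obtain ⟨k', hk'⟩ := exists_le_of_topicMatrices hcA hA j
  have e : k' = k := by
    by_contra hne
    rw [h k' hne] at hk'
    exact hpos.not_ge hk'
  rw [e] at hk'
  exact ⟨⟨hpos.trans_le hk', h⟩, hk'⟩

/-- The words for which topic `k` is needed to bound the row of the topic matrix below. -/
def dominatedWords {p K : ℕ} (cA : ℝ) (A : Fin K → Simplex p) (k : Fin K) : Finset (Fin p) := by
  classical exact Finset.univ.filter fun j => ∀ k', k' ≠ k → A k' j < cA / p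

lemma mem_dominatedWords {p K : ℕ} {cA : ℝ} {A : Fin K → Simplex p} {k : Fin K} {j : Fin p} :
    j ∈ dominatedWords cA A k ↔ ∀ k', k' ≠ k → A k' j < cA / p := by
  simp [dominatedWords]

lemma mem_anchorWords {p K : ℕ} {A : Fin K → Simplex p} {j : Fin p} :
    j ∈ anchorWords A ↔ ∃ k, IsAnchor A j k := by
  simp [anchorWords]

lemma comp_perm_mem_topicMatrices {p K : ℕ} {cA cm : ℝ} (hcA : 0 < cA) {A : Fin K → Simplex p}
    (hA : A ∈ topicMatrices p K cA cm) (σ : Equiv.Perm (Fin K)) :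
    A ∘ σ ∈ topicMatrices p K cA cm := by
  have hanchor : ∀ j k, IsAnchor (A ∘ σ) j k ↔ IsAnchor A j (σ k) := fun j k => by
    refine and_congr Iff.rfl ⟨fun h k' hk' => ?_, fun h k' hk' => h _ (σ.injective.ne hk')⟩
    have := h (σ.symm k') (fun e => hk' (by rw [← e, Equiv.apply_symm_apply]))
    simpa using this
  refine ⟨fun j => ?_, fun k => ?_, ?_⟩
  · obtain ⟨k, hk⟩ := exists_le_of_topicMatrices hcA hA j
    refine hk.trans ?_
    have := norm_le_pi_norm (fun k => (A ∘ σ) k j) (σ.symm k)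
    simp only [Function.comp_apply, Equiv.apply_symm_apply, Real.norm_eq_abs] at this
    exact (le_abs_self _).trans this
  · obtain ⟨j, hj⟩ := hA.2.1 (σ k)
    exact ⟨j, (hanchor j k).2 hj⟩
  · refine le_trans ?_ hA.2.2
    refine Nat.cast_le.2 (Finset.card_le_card fun j hj => ?_)
    rw [mem_anchorWords] at hj ⊢
    obtain ⟨k, hk⟩ := hj
    exact ⟨σ k, (hanchor j k).1 hk⟩

/-- Pigeonhole: every row has an entry at least `cA / p`, so no word can be dominated for two
different topics and these `K` sets are disjoint. -/
lemma exists_card_dominatedWords_le {p K : ℕ} {cA cm : ℝ} (hcA : 0 < cA) {A : Fin K → Simplex p}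
    (hA : A ∈ topicMatrices p K cA cm) (hK : 0 < K) :
    ∃ k, ((dominatedWords cA A k).card : ℝ) * K ≤ p := by
  classical
  have hdisj : ((Finset.univ : Finset (Fin K)) : Set (Fin K)).PairwiseDisjoint (dominatedWords cA A) := by
    intro k _ k' _ hne
    refine Finset.disjoint_left.2 fun j hj hj' => ?_
    rw [mem_dominatedWords] at hj hj'
    obtain ⟨k'', hk''⟩ := exists_le_of_topicMatrices hcA hA j
    by_cases h : k'' = k
    · exact hk''.not_gt (hj' k'' (h ▸ hne))
    · exact hk''.not_gt (hj k'' h)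
  have hsum : ∑ k, ((dominatedWords cA A k).card : ℝ) ≤ p := by
    have h := Finset.card_le_univ (Finset.univ.biUnion (dominatedWords cA A))
    rw [Finset.card_biUnion hdisj, Fintype.card_fin] at h
    exact_mod_cast h
  by_contra! hlt
  have : Nonempty (Fin K) := ⟨⟨0, hK⟩⟩
  have hK' : (0 : ℝ) < K := by exact_mod_cast hK
  have h := Finset.sum_lt_sum_of_nonempty Finset.univ_nonempty fun k (_ : k ∈ Finset.univ) => hlt k
  rw [← Finset.sum_mul] at h
  simp only [Finset.sum_const, Finset.card_univ, Fintype.card_fin, nsmul_eq_mul] at h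
  nlinarith

/-- Every topic can be made the one that is needed for few words. -/
lemma exists_topicMatrix_slack {p K : ℕ} {cA cm : ℝ} (hcA : 0 < cA) {A : Fin K → Simplex p}
    (hA : A ∈ topicMatrices p K cA cm) (k : Fin K) :
    ∃ A' ∈ topicMatrices p K cA cm, ((dominatedWords cA A' k).card : ℝ) * K ≤ p := by
  obtain ⟨k₀, hk₀⟩ := exists_card_dominatedWords_le hcA hA k.pos
  refine ⟨A ∘ Equiv.swap k k₀, comp_perm_mem_topicMatrices hcA hA _, ?_⟩
  have e : dominatedWords cA (A ∘ Equiv.swap k k₀) k ⊆ dominatedWords cA A k₀ := fun j hj => by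
    rw [mem_dominatedWords] at hj ⊢
    intro k' hk'
    have := hj (Equiv.swap k k₀ k') (fun h => hk' (by
      rw [← Equiv.swap_apply_self k k₀ k', h, Equiv.swap_apply_left] ))
    simpa using this
  refine le_trans ?_ hk₀
  gcongr

lemma one_sub_mul_le_card_compl {p K : ℕ} {cA cm : ℝ} {A : Fin K → Simplex p}
    (hA : A ∈ topicMatrices p K cA cm) : (1 - cm) * p ≤ ((anchorWords A)ᶜ.card : ℝ) := by
  have h := Finset.card_add_card_compl (anchorWords A)
  rw [Fintype.card_fin] at h
  have h' : ((anchorWords A).card : ℝ) + (anchorWords A)ᶜ.card = p := by exact_mod_cast h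
  linarith [hA.2.2]

lemma pos_of_simplex {m : ℕ} (u : Simplex m) : 0 < m := by
  rcases Nat.eq_zero_or_pos m with rfl | h
  · have := sum_simplex u
    simp at this
  · exact h

/-- A nonempty class of topic matrices has `cA < K`. -/
lemma lt_card_of_mem_topicMatrices {p K : ℕ} {cA cm : ℝ} (hcA : 0 < cA) (hcm : cm < 1)
    {A : Fin K → Simplex p} (hA : A ∈ topicMatrices p K cA cm) (hK : 0 < K) : cA < K := by
  have hp : (0 : ℝ) < p := by exact_mod_cast pos_of_simplex (A ⟨0, hK⟩)
  have hcard := one_sub_mul_le_card_compl hA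
  have hpos : (0 : ℝ) < ((anchorWords A)ᶜ.card : ℝ) :=
    lt_of_lt_of_le (mul_pos (by linarith) hp) hcard
  obtain ⟨j₀, hj₀⟩ := Finset.card_pos.1 (by exact_mod_cast hpos)
  have hle : ∀ j k, A k j ≤ ∑ k', A k' j := fun j k =>
    Finset.single_le_sum (f := fun k' => A k' j) (fun k' _ => simplex_nonneg _ _)
      (Finset.mem_univ k)
  have h1 : ∀ j, cA / p ≤ ∑ k, A k j := fun j => by
    obtain ⟨k, hk⟩ := exists_le_of_topicMatrices hcA hA j
    exact hk.trans (hle j k)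
  have h2 : cA / p < ∑ k, A k j₀ := by
    obtain ⟨k, hk⟩ := exists_le_of_topicMatrices hcA hA j₀
    -- Equality would leave `j₀` in topic `k` alone and so make it an anchor word. One strict
    -- inequality among the rows makes the total `K` exceed `cA`.
    refine hk.trans_lt ((hle j₀ k).lt_of_ne fun e => ?_)
    refine (Finset.mem_compl.1 hj₀) (mem_anchorWords.2 ⟨k, (isAnchor_of_forall_eq_zero hcA hA ?_).1⟩)
    rw [← Finset.add_sum_erase _ _ (Finset.mem_univ k), left_eq_add] at e
    intro k' hk'
    exact (Finset.sum_eq_zero_iff_of_nonneg fun _ _ => simplex_nonneg _ _).1 e k'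
      (Finset.mem_erase.2 ⟨hk', Finset.mem_univ _⟩)
  have h3 := Finset.sum_lt_sum (fun j _ => h1 j) ⟨j₀, Finset.mem_univ _, h2⟩
  rw [Finset.sum_comm] at h3
  simp only [sum_simplex, Finset.sum_const, Finset.card_univ, Fintype.card_fin, nsmul_eq_mul,
    mul_one] at h3
  rwa [mul_div_cancel₀ _ hp.ne'] at h3

/-- One column of a topic matrix can be replaced if it is large enough where it is needed, positive
at the words that are not anchor words and zero at the anchor words of the other topics. -/
lemma update_mem_topicMatrices {p K : ℕ} {cA cm : ℝ} (hcA : 0 < cA) {A : Fin K → Simplex p}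
    (hA : A ∈ topicMatrices p K cA cm) {k : Fin K} {θ : Simplex p}
    (h1 : ∀ j ∈ dominatedWords cA A k, cA / p ≤ θ j) (h2 : ∀ j ∈ (anchorWords A)ᶜ, 0 < θ j)
    (h3 : ∀ j k', k' ≠ k → IsAnchor A j k' → θ j = 0) :
    Function.update A k θ ∈ topicMatrices p K cA cm := by
  refine ⟨fun j => ?_, fun k' => ?_, ?_⟩
  · have key : ∃ k', cA / p ≤ Function.update A k θ k' j := by
      by_cases hj : j ∈ dominatedWords cA A k
      · exact ⟨k, by simpa using h1 j hj⟩
      · rw [mem_dominatedWords] at hj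
        push Not at hj
        obtain ⟨k', hk', h⟩ := hj
        exact ⟨k', by simpa [hk'] using h⟩
    obtain ⟨k', hk'⟩ := key
    exact hk'.trans ((le_abs_self _).trans
      (norm_le_pi_norm (fun k' => Function.update A k θ k' j) k'))
  · obtain ⟨j, hj⟩ := hA.2.1 k'
    have hp : (0 : ℝ) < p := by exact_mod_cast j.pos
    refine ⟨j, ?_⟩
    by_cases hk : k' = k
    · subst hk
      have hd : j ∈ dominatedWords cA A k' := mem_dominatedWords.2 fun k'' hk'' => by
        rw [hj.2 k'' hk'']; positivity
      refine ⟨?_, fun k'' hk'' => by simpa [hk''] using hj.2 k'' hk''⟩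
      rw [Function.update_self]
      exact lt_of_lt_of_le (by positivity) (h1 j hd)
    · refine ⟨by simpa [hk] using hj.1, fun k'' hk'' => ?_⟩
      by_cases hk2 : k'' = k
      · subst hk2
        rw [Function.update_self]
        exact h3 j k' hk hj
      · simpa [hk2] using hj.2 k'' hk''
  · refine le_trans (Nat.cast_le.2 (Finset.card_le_card fun j hj => ?_)) hA.2.2
    by_contra hj'
    obtain ⟨k', hk'⟩ := mem_anchorWords.1 hj
    by_cases hk : k' = k
    · subst hk
      refine hj' (mem_anchorWords.2 ⟨k', (isAnchor_of_forall_eq_zero hcA hA fun k'' hk'' => ?_).1⟩)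
      simpa [hk''] using hk'.2 k'' hk''
    · have h := hk'.2 k (Ne.symm hk)
      rw [Function.update_self] at h
      exact (h2 j (Finset.mem_compl.2 hj')).ne' h

/-- A family of topic matrices in which one column can be perturbed. -/
lemma exists_perturbable_topic {p K : ℕ} {cA cm : ℝ} (hcA : 0 < cA) (hcm : cm < 1)
    {A₀ : Fin K → Simplex p} (hA₀ : A₀ ∈ topicMatrices p K cA cm) (k : Fin K) :
    ∃ (A : Fin K → Simplex p) (β : Simplex p) (J : Finset (Fin p)) (o : Fin p) (s : ℝ),
      1 - cA / K ≤ s ∧ s ≤ 1 ∧ 0 < s ∧ (1 - cm) * p ≤ J.card ∧ J.Nonempty ∧ o ∉ J ∧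
      (∀ b ∈ J, s / (2 * J.card) ≤ β b) ∧ s / 2 ≤ β o ∧
      ∀ (g : ℝ) (h : Perturbable β J o g), 2 * g ≤ s / (2 * J.card) → ∀ ω,
        Function.update A k (h.point ω) ∈ topicMatrices p K cA cm := by
  obtain ⟨A, hA, hR⟩ := exists_topicMatrix_slack hcA hA₀ k
  have hp : (0 : ℝ) < p := by exact_mod_cast pos_of_simplex (A k)
  have hK : (0 : ℝ) < K := by exact_mod_cast k.pos
  have hcAK := lt_card_of_mem_topicMatrices hcA hcm hA k.pos
  obtain ⟨o, ho⟩ := hA.2.1 k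
  set R := dominatedWords cA A k with hRdef
  set J := (anchorWords A)ᶜ with hJdef
  -- The mass of the topic left free once every word of `R` has received its compulsory `cA / p`.
  set s : ℝ := 1 - R.card * (cA / p) with hs
  have hJcard := one_sub_mul_le_card_compl hA
  have hJpos : (0 : ℝ) < J.card := lt_of_lt_of_le (mul_pos (by linarith) hp) hJcard
  have hJne : J.Nonempty := Finset.card_pos.1 (by exact_mod_cast hJpos)
  have hs1 : 1 - cA / K ≤ s := by
    have : R.card * (cA / p) ≤ cA / K := by
      rw [mul_div_assoc', div_le_div_iff₀ hp hK]
      nlinarith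
    linarith
  have hs2 : s ≤ 1 := by
    have : 0 ≤ R.card * (cA / p) := by positivity
    linarith
  have hs0 : 0 < s := lt_of_lt_of_le (by rw [sub_pos, div_lt_one hK]; exact hcAK) hs1
  have hoJ : o ∉ J := by simpa [hJdef] using mem_anchorWords.2 ⟨k, ho⟩
  -- Half of the free mass sits on an anchor word `o` of the topic, to balance perturbations; the
  -- other half is uniform over the non-anchor words.
  let β : Simplex p := ⟨fun j => (if j ∈ R then cA / p else 0) + (if j = o then s / 2 else 0) +
    if j ∈ J then s / (2 * J.card) else 0, fun j => by positivity, by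
      simp only [Finset.sum_add_distrib, Finset.sum_ite_mem, Finset.univ_inter, Finset.sum_const,
        nsmul_eq_mul, Finset.sum_ite_eq', Finset.mem_univ, if_true]
      field_simp
      rw [hs]
      field_simp
      ring⟩
  have hβ : ∀ j, β j = (if j ∈ R then cA / p else 0) + (if j = o then s / 2 else 0) +
      if j ∈ J then s / (2 * J.card) else 0 := fun j => rfl
  have hR0 : ∀ j, (0 : ℝ) ≤ if j ∈ R then cA / p else 0 := fun j => by positivity
  refine ⟨A, β, J, o, s, hs1, hs2, hs0, hJcard, hJne, hoJ, fun b hb => ?_, ?_, fun g h hg ω => ?_⟩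
  · have hbo : b ≠ o := fun e => hoJ (e ▸ hb)
    rw [hβ, if_pos hb, if_neg hbo]
    linarith [hR0 b]
  · rw [hβ, if_pos rfl, if_neg hoJ]
    linarith [hR0 o]
  · have hpos : 0 < s / (2 * J.card) := by positivity
    -- Perturbations draw only on the free mass, never on the compulsory part.
    have hlow : ∀ j, (if j ∈ R then cA / p else 0) ≤ h.point ω j := fun j => by
      rw [h.point_apply]
      by_cases hj : j ∈ J
      · have hjo : j ≠ o := fun e => hoJ (e ▸ hj)
        have e := perturbFun_mem β hoJ g ω ⟨j, hj⟩
        change perturbFun β J o g ω j = β j + _ at e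
        rw [e, hβ, if_pos hj, if_neg hjo]
        nlinarith [h.nonneg, neg_one_le_bitSign (ω ⟨j, hj⟩)]
      · by_cases hjo : j = o
        · subst hjo
          have h2 : ∑ b : J, bitSign (ω b) ≤ J.card := by
            simpa using Finset.sum_le_sum fun b (_ : b ∈ Finset.univ) => bitSign_le_one (ω b)
          have h3 : g * J.card ≤ s / 4 := by
            calc g * J.card ≤ s / (2 * J.card) / 2 * J.card := by gcongr; linarith
              _ = s / 4 := by field_simp; norm_num
          rw [perturbFun_balance β hoJ, hβ, if_pos rfl, if_neg hoJ]
          linarith [mul_le_mul_of_nonneg_left h2 h.nonneg]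
        · rw [perturbFun_of_ne β hj hjo, hβ, if_neg hjo, if_neg hj]
          linarith
    refine update_mem_topicMatrices hcA hA (fun j hj => ?_) (fun j hj => ?_) (fun j k' hk' hj => ?_)
    · simpa [hRdef, hj] using hlow j
    · have hjo : j ≠ o := fun e => hoJ (e ▸ hj)
      have h1 := h.half_le_point ω j
      rw [hβ, if_pos hj, if_neg hjo] at h1
      linarith [hR0 j]
    · have hjJ : j ∉ J := by simpa [hJdef] using mem_anchorWords.2 ⟨k', hj⟩
      have hjo : j ≠ o := fun e => by
        have := hj.1
        rw [e, ho.2 k' hk'] at this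
        exact this.false
      have hjR : j ∉ R := fun hjR =>
        (isAnchor_of_forall_eq_zero hcA hA hj.2).2.not_gt (mem_dominatedWords.1 hjR k' hk')
      refine h.point_eq_zero ω hjJ hjo ?_
      rw [hβ, if_neg hjR, if_neg hjo, if_neg hjJ]
      norm_num

lemma wordProb_update_sub {p K : ℕ} (A : Fin K → Simplex p) (k : Fin K) (θ θ' : Simplex p)
    (α : Simplex K) (j : Fin p) :
    wordProb (Function.update A k θ) α j - wordProb (Function.update A k θ') α j =
      α k * (θ j - θ' j) := by
  rw [wordProb, wordProb, ← Finset.sum_sub_distrib, Finset.sum_eq_single k]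
  · simp only [Function.update_self]; ring
  · intro k' _ hk'
    simp [hk']
  · simp

lemma mul_le_wordProb_update {p K : ℕ} (A : Fin K → Simplex p) (k : Fin K) (θ : Simplex p)
    (α : Simplex K) (j : Fin p) : α k * θ j ≤ wordProb (Function.update A k θ) α j := by
  have := Finset.single_le_sum (f := fun k' => Function.update A k θ k' j * α k')
    (fun k' _ => mul_nonneg (simplex_nonneg _ _) (simplex_nonneg _ _)) (Finset.mem_univ k)
  simp only [Function.update_self] at this
  rwa [mul_comm]

/-- The topic enters the document with factor `α k` in both the difference and the lower bound of
the sum. The deficit is therefore linear in `α k`, so that over the corpus only the total weight of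
the topic matters. -/
lemma Perturbable.one_sub_affinity_topics_le {p K : ℕ} (A : Fin K → Simplex p) (k : Fin K)
    {β : Simplex p} {J : Finset (Fin p)} {o : Fin p} {g x : ℝ} (h : Perturbable β J o g)
    (hx : 0 < x) (hJ : ∀ b ∈ J, x ≤ β b) (ho : x ≤ β o) (ω : J → Bool) (b : J)
    (α : Simplex K) :
    1 - ∑ j, √(wordProb (Function.update A k (h.point ω)) α j *
      wordProb (Function.update A k (h.point (flipBit b ω))) α j) ≤ 4 * g ^ 2 / x * α k := by
  have hbo : (b : Fin p) ≠ o := fun e => h.notMem (e ▸ b.2)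
  have hα := simplex_nonneg α k
  refine (one_sub_affinity_le (w := fun j => α k * ((if j = b then 1 else 0) +
    if j = o then 1 else 0)) (g := 2 * g) (y := x) (wordProb_nonneg _ _) (wordProb_nonneg _ _)
    (sum_wordProb _ _) (sum_wordProb _ _) hx (fun j => by positivity) (fun j => ?_)
    (fun j => ?_)).trans (le_of_eq ?_)
  · rw [wordProb_update_sub, h.point_sub_flip, abs_mul, abs_mul, abs_mul, abs_bitSign, mul_one,
      abs_of_nonneg hα, abs_of_nonneg (by linarith [h.nonneg]), mul_left_comm]
    refine mul_le_mul_of_nonneg_left (mul_le_mul_of_nonneg_left ?_ hα) (by linarith [h.nonneg])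
    rw [exchange]
    split_ifs <;> norm_num
  · have h1 : α k * β j ≤ wordProb (Function.update A k (h.point ω)) α j +
        wordProb (Function.update A k (h.point (flipBit b ω))) α j := by
      refine le_trans ?_ (add_le_add (mul_le_wordProb_update A k _ α j)
        (mul_le_wordProb_update A k _ α j))
      rw [← mul_add]
      exact mul_le_mul_of_nonneg_left
        (by linarith [h.half_le_point ω j, h.half_le_point (flipBit b ω) j]) hα
    refine le_trans ?_ h1
    rw [mul_left_comm]
    refine mul_le_mul_of_nonneg_left ?_ hα
    by_cases hb : j = b
    · have := hJ b b.2
      simp only [hb, hbo, if_true, if_false]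
      linarith
    · by_cases hj : j = o
      · simp only [hj, Ne.symm hbo, if_true, if_false]
        linarith
      · simp only [hb, hj, if_false]
        linarith [simplex_nonneg β j]
  · simp only [← Finset.mul_sum, Finset.sum_add_distrib, Finset.sum_ite_eq', Finset.mem_univ,
      if_true]
    field_simp
    ring

lemma Perturbable.sum_one_sub_affinity_topics_le {p K n : ℕ} (A : Fin K → Simplex p) (k : Fin K)
    {β : Simplex p} {J : Finset (Fin p)} {o : Fin p} {g x : ℝ} (h : Perturbable β J o g)
    (hx : 0 < x) (hJ : ∀ b ∈ J, x ≤ β b) (ho : x ≤ β o) (ω : J → Bool) (b : J)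
    (α : Fin n → Simplex K) :
    ∑ i, (1 - ∑ j, √(wordProb (Function.update A k (h.point ω)) (α i) j *
      wordProb (Function.update A k (h.point (flipBit b ω))) (α i) j)) ≤
      4 * g ^ 2 / x * ∑ i, α i k := by
  rw [Finset.mul_sum]
  exact Finset.sum_le_sum fun i _ => h.one_sub_affinity_topics_le A k hx hJ ho ω b (α i)

lemma le_of_admissibleWeights_nonempty {K n τ : ℕ} {i : Fin n} {T : Fin n → Simplex K}
    (hne : (admissibleWeights τ i T).Nonempty) : K ≤ n := by
  obtain ⟨α, -, h⟩ := hne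
  have := (Matrix.of fun (k : Fin K) (i' : Fin n) => Function.update T i α i' k).rank_le_width
  omega

/-- Some topic has a small total weight, and there are admissible weights that put at least half of
the mass on it. -/
lemma exists_light_topic {K n τ : ℕ} {i : Fin n} {T : Fin n → Simplex K} (hτ : 1 < τ)
    (hne : (admissibleWeights τ i T).Nonempty) :
    ∃ k, ∃ α ∈ admissibleWeights τ i T, 1 / 2 ≤ α k ∧
      K * ∑ i', Function.update T i α i' k ≤ 2 * n := by
  have hKn := le_of_admissibleWeights_nonempty hne
  obtain ⟨h, ⟨l, hl⟩, hadm⟩ := exists_functional hne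
  have : Nonempty (Fin K) := ⟨l⟩
  obtain ⟨k, hk⟩ := Finite.exists_min fun k => ∑ i' ∈ Finset.univ.erase i, T i' k
  have hsum : K * ∑ i' ∈ Finset.univ.erase i, T i' k ≤ (n : ℝ) := by
    calc (K : ℝ) * ∑ i' ∈ Finset.univ.erase i, T i' k
        = ∑ _k' : Fin K, ∑ i' ∈ Finset.univ.erase i, T i' k := by
          rw [Finset.sum_const, Finset.card_univ, Fintype.card_fin, nsmul_eq_mul]
      _ ≤ ∑ k', ∑ i' ∈ Finset.univ.erase i, T i' k' := Finset.sum_le_sum fun k' _ => hk k'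
      _ = ((Finset.univ.erase i).card : ℝ) := by
        rw [Finset.sum_comm]
        simp only [sum_simplex]
        simp
      _ ≤ n := by
        have := Finset.card_le_univ (Finset.univ.erase i)
        rw [Fintype.card_fin] at this
        exact_mod_cast this
  -- The weights put `1 - t` on the lightest topic `k` and `t` on `l`, where `h l ≠ 0`. Document `i`
  -- adds at most one to the total weight, absorbed by `K ≤ n`.
  have hmain : ∀ t : ℝ, ∀ (h0 : 0 ≤ t) (h1 : t ≤ 1 / 2), (1 - t) * h k + t * h l ≠ 0 →
      ∃ k, ∃ α ∈ admissibleWeights τ i T, 1 / 2 ≤ α k ∧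
        K * ∑ i', Function.update T i α i' k ≤ 2 * n := fun t h0 h1 hth => by
    set α := twoLevel {l} (Finset.singleton_nonempty l) k h0 (by linarith) with hα
    have hαa : ∀ k', α k' = (if k' = k then 1 - t else 0) + if k' = l then t else 0 := fun k' => by
      simp [hα, twoLevel_apply]
    have hs : α ∈ sparseWeights K τ := by
      have hsub : supp α ⊆ {k, l} := fun k' hk' => by
        by_contra hn
        simp only [Finset.mem_insert, Finset.mem_singleton, not_or] at hn
        refine (Finset.mem_filter.1 hk').2 ?_
        simp [hαa, hn]
      have := (Finset.card_le_card hsub).trans Finset.card_le_two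
      change (supp α).card ≤ τ
      omega
    refine ⟨k, α, hadm α hs ?_, ?_, ?_⟩
    · convert hth using 1
      simp only [hαa, mul_add, Finset.sum_add_distrib, mul_ite, mul_zero, Finset.sum_ite_eq',
        Finset.mem_univ, if_true]
      ring
    · rw [hαa, if_pos rfl]
      split_ifs <;> linarith
    · rw [← Finset.add_sum_erase _ _ (Finset.mem_univ i), Function.update_self,
        Finset.sum_congr rfl fun i' hi' => by rw [Function.update_of_ne (Finset.ne_of_mem_erase hi')]]
      have h2 : (K : ℝ) ≤ n := by exact_mod_cast hKn
      nlinarith [simplex_le_one α k]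
  -- One of two values of `t` avoids the hyperplane: `t = 1 / 2` fails only if `h k = -h l`, and
  -- then `t = 1 / 4` gives `-h l / 2`.
  by_cases h2 : h k + h l = 0
  · refine hmain (1 / 4) (by norm_num) (by norm_num) fun h3 => hl ?_
    linarith
  · refine hmain (1 / 2) (by norm_num) le_rfl fun h3 => h2 ?_
    linarith

lemma topics_lower_bound {p K n N τ : ℕ} {d : MetricSpace (Simplex p)} {cA cm cd c' s₀ : ℝ}
    (hcd : 0 < cd) (hd : ∀ u v : Simplex p, cd * l1Dist u v ≤ 2 * d.dist u v) {i : Fin n}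
    {T : Fin n → Simplex K} (hcA : 0 < cA) (hcm : 0 < cm) (hcm' : cm < 1) (hτ : 1 < τ)
    (hN : 0 < N) (hpK : (p * K : ℝ) ≤ c' * (n * N))
    (hne : (admissibleWeights τ i T).Nonempty) {A₀ : Fin K → Simplex p}
    (hA₀ : A₀ ∈ topicMatrices p K cA cm) (hs₀ : cA < K → s₀ ≤ 1 - cA / K) :
    ENNReal.ofReal (s₀ * (1 - cm) / (128 * (2 * √c' + 3)) * cd * √(p * K / (n * N))) ≤
      minimaxRisk d cA cm N τ i T := by
  obtain ⟨k, α, hα, hαk, hlight⟩ := exists_light_topic hτ hne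
  obtain ⟨A, β, J, o, s, hs1, hs2, hs0, hJcard, hJne, hoJ, hβJ, hβo, hmem⟩ :=
    exists_perturbable_topic hcA hcm' hA₀ k
  have hN' : (0 : ℝ) < N := by exact_mod_cast hN
  have hn : (0 : ℝ) < n := by exact_mod_cast i.pos
  have hK : (0 : ℝ) < K := by exact_mod_cast k.pos
  have hp : (0 : ℝ) < p := by exact_mod_cast o.pos
  have hJpos : (1 : ℝ) ≤ J.card := by exact_mod_cast hJne.card_pos
  have hs₀s : s₀ ≤ s := (hs₀ (lt_card_of_mem_topicMatrices hcA hcm' hA₀ k.pos)).trans hs1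
  have hcm0 : 0 < 1 - cm := by linarith
  -- Again the relative size. The factor `1 - cm` cancels the one in `J.card ≥ (1 - cm) * p` when
  -- the affinity budget `1 / 2` is computed.
  obtain ⟨δ, hδ⟩ : ∃ δ, δ = (1 - cm) / (2 * √c' + 3) * √(p * K / (n * N)) := ⟨_, rfl⟩
  have hc0 := Real.sqrt_nonneg c'
  have hδ0 : 0 ≤ δ := by rw [hδ]; positivity
  have hsq : √(p * K / (n * N)) ≤ √c' := Real.sqrt_le_sqrt ((div_le_iff₀ (by positivity)).2 hpK)
  have hδ1 : δ ≤ 1 / 2 := by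
    rw [hδ, div_mul_eq_mul_div, div_le_iff₀ (by positivity)]
    have := mul_le_of_le_one_left (Real.sqrt_nonneg (p * K / (n * N) : ℝ))
      (by linarith : 1 - cm ≤ 1)
    linarith
  have hδ2 : δ ^ 2 ≤ (1 - cm) * (p * K / (n * N)) / 8 := by
    rw [hδ, mul_pow, Real.sq_sqrt (by positivity)]
    have : ((1 - cm) / (2 * √c' + 3)) ^ 2 ≤ (1 - cm) / 8 := by
      rw [div_pow]
      have h3 : (3 : ℝ) ≤ 2 * √c' + 3 := by linarith
      have h8 : (8 : ℝ) ≤ (2 * √c' + 3) ^ 2 :=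
        (by norm_num : (8 : ℝ) ≤ 3 ^ 2).trans (pow_le_pow_left₀ (by norm_num) h3 2)
      exact div_le_div₀ hcm0.le (pow_le_of_le_one hcm0.le (by linarith) two_ne_zero)
        (by norm_num) h8
    calc _ ≤ (1 - cm) / 8 * (p * K / (n * N) : ℝ) := by gcongr
      _ = _ := by ring
  obtain ⟨x, hx⟩ : ∃ x, x = s / (2 * J.card) := ⟨_, rfl⟩
  simp only [← hx] at hβJ hmem
  have hx0 : 0 < x := by rw [hx]; positivity
  have hxo : x ≤ β o := by
    refine le_trans ?_ hβo
    rw [hx, div_le_div_iff₀ (by positivity) (by positivity)]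
    exact mul_le_mul_of_nonneg_left (by linarith) hs0.le
  have hδx : δ * x ≤ 1 / 2 * x := mul_le_mul_of_nonneg_right hδ1 hx0.le
  have hpert : Perturbable β J o (δ * x) :=
    { notMem := hoJ
      nonneg := by positivity
      le := fun b hb => by linarith [hβJ b hb]
      le_balance := by
        refine le_trans ?_ hβo
        have : (J.card : ℝ) * (δ * x) = δ * s / 2 := by rw [hx]; field_simp
        rw [this]
        linarith [mul_le_mul_of_nonneg_right hδ1 hs0.le] }
  have hmain := le_minimaxRisk (N := N) (A := fun ω => Function.update A k (hpert.point ω))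
    (α := fun _ => α) hcd hd (fun ω => hmem _ hpert (by linarith) ω) (fun _ => hα)
    (ε := δ * x) (by positivity) (fun ω ω' => ?_) (fun ω b => ?_)
  · refine (ENNReal.ofReal_le_ofReal ?_).trans hmain
    rw [Fintype.card_coe]
    have e : cd * (δ * x) * J.card / 64 = s / 128 * (cd * δ) := by rw [hx]; field_simp; ring
    have e' : s₀ * (1 - cm) / (128 * (2 * √c' + 3)) * cd * √(p * K / (n * N)) =
        s₀ / 128 * (cd * δ) := by rw [hδ]; field_simp
    rw [e, e']
    gcongr
  -- Here `1 / 2 ≤ α k` is used: document `i` sees at least half of the change in the topic.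
  · simp only [wordProb_update_sub, abs_mul, ← Finset.mul_sum]
    have h1 := hpert.hammingDist_le ω ω'
    rw [abs_of_nonneg (simplex_nonneg α k)]
    have h2 : (0 : ℝ) ≤ ∑ j, |hpert.point ω j - hpert.point ω' j| :=
      Finset.sum_nonneg fun _ _ => abs_nonneg _
    linarith [mul_le_mul_of_nonneg_right hαk h2]
  · refine (mul_le_mul_of_nonneg_left (hpert.sum_one_sub_affinity_topics_le A k hx0 hβJ hxo ω b
      (Function.update T i α)) hN'.le).trans ?_
    have h2 : 4 * (δ * x) ^ 2 / x = 4 * δ ^ 2 * x := by field_simp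
    rw [h2]
    have h3 : ∑ i', Function.update T i α i' k ≤ 2 * n / K := by
      rw [le_div_iff₀ hK, mul_comm]; exact hlight
    have h4 : x ≤ 1 / (2 * ((1 - cm) * p)) := by
      rw [hx]; gcongr
    have h0 : 0 ≤ ∑ i', Function.update T i α i' k :=
      Finset.sum_nonneg fun i' _ => simplex_nonneg _ _
    generalize ∑ i', Function.update T i α i' k = M at h3 h0 ⊢
    calc N * (4 * δ ^ 2 * x * M) ≤ N * (4 * ((1 - cm) * (p * K / (n * N)) / 8) * (1 / (2 * ((1 - cm) * p))) *
          (2 * n / K)) := by gcongr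
      _ = 1 / 2 := by field_simp; norm_num

end TopicModel

end

/-! ### Combination of the two lower bounds -/

theorem mainTheorem8 (cA cm c c' : ℝ) (hcA : 0 < cA) (hcm : 0 < cm) (hcm' : cm < 1)
    (hc : 0 < c) (hc' : 0 < c') :
    ∃ C : ℝ, 0 < C ∧
      ∀ (p K n N τ : ℕ) (d : MetricSpace (TopicModel.Simplex p)) (cd : ℝ)
        (i : Fin n) (T : Fin n → TopicModel.Simplex K),
        1 < τ → τ ≤ K → (τ : ℝ) ≤ c * N → (p * K : ℝ) ≤ c' * (n * N) →
        0 < cd → (∀ u v : TopicModel.Simplex p, cd * TopicModel.l1Dist u v ≤ 2 * d.dist u v) →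
        (TopicModel.admissibleWeights τ i T).Nonempty →
        ∀ A₀ ∈ TopicModel.topicMatrices p K cA cm,
          ENNReal.ofReal (C * cd * (TopicModel.kappaBar A₀ τ * √(τ / N) + √(p * K / (n * N)))) ≤
            TopicModel.minimaxRisk d cA cm N τ i T := by
  -- The free mass is at least `1 - cA / K`. As `K` is an integer exceeding `cA`, it is at least
  -- `⌊cA⌋₊ + 1`, so this bound is positive uniformly in `K`.
  set s₀ : ℝ := 1 - cA / (⌊cA⌋₊ + 1) with hs₀
  have hs₀pos : 0 < s₀ := by
    rw [hs₀, sub_pos, div_lt_one (by positivity)]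
    exact Nat.lt_floor_add_one cA
  set C₁ : ℝ := 1 / (128 * (2 * √c + 3)) with hC₁
  set C₂ : ℝ := s₀ * (1 - cm) / (128 * (2 * √c' + 3)) with hC₂
  have hC₁pos : 0 < C₁ := by positivity
  have hC₂pos : 0 < C₂ := by
    have : 0 < 1 - cm := by linarith
    positivity
  refine ⟨min C₁ C₂ / 2, by positivity, ?_⟩
  intro p K n N τ d cd i T hτ hτK hτN hpK hcd hd hne A₀ hA₀
  have hN : 0 < N := by
    have h0 : (0 : ℝ) < c * N := lt_of_lt_of_le (by exact_mod_cast zero_lt_one.trans hτ) hτN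
    exact_mod_cast pos_of_mul_pos_right h0 hc.le
  have h1 := TopicModel.weights_lower_bound hcd hd hc hτ hτK hτN hne hA₀
  have h2 := TopicModel.topics_lower_bound (s₀ := s₀) hcd hd hcA hcm hcm' hτ hN hpK hne hA₀
    fun hcAK => by
      have h3 : ((⌊cA⌋₊ : ℝ) + 1) ≤ K := by
        exact_mod_cast (Nat.floor_lt hcA.le).2 hcAK
      rw [hs₀]
      gcongr
  have hκ := TopicModel.kappaBar_nonneg A₀ τ
  set a := TopicModel.kappaBar A₀ τ * √(τ / N)
  set b := √(p * K / (n * N) : ℝ)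
  have ha : 0 ≤ cd * a := by positivity
  have hb : 0 ≤ cd * b := by positivity
  -- The larger of the two terms is at least half their sum, whence the `/ 2` in the constant.
  rcases le_total a b with hab | hab
  · refine le_trans (ENNReal.ofReal_le_ofReal ?_) h2
    nlinarith [mul_le_mul_of_nonneg_right (min_le_right C₁ C₂) hb,
      mul_le_mul_of_nonneg_left hab (mul_nonneg (le_min hC₁pos.le hC₂pos.le) hcd.le)]
  · refine le_trans (ENNReal.ofReal_le_ofReal ?_) h1
    nlinarith [mul_le_mul_of_nonneg_right (min_le_left C₁ C₂) ha,
      mul_le_mul_of_nonneg_left hab (mul_nonneg (le_min hC₁pos.le hC₂pos.le) hcd.le)]
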